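/- Let $D_x=-i\partial_x$, $D_y=-i\partial_y$ and $\langle t\rangle=(1+t^2)^{1/2}$. In $L^2(\mathbb R^2)=L^2(\mathbb R^2;\mathbb C)$ let $H_0=(D_x+y)^2+D_y^2+x$, defined as the closure of this differential operator on $C_0^\infty(\mathbb R^2)$. Let $V:\mathbb R^2\to\mathbb R$ be a continuous function whose partial derivative $V_x=\partial_xV$ exists everywhere and is continuous on $\mathbb R^2$, and let $H=H_0+V$ with domain $D(H)=D(H_0)$. Assume that there is a constant $A_2$ with $$\|\langle x\rangle^{1/2}\langle y\rangle V\|_{L^\infty(\mathbb R^2)}\le A_2,$$ and that $$\langle x\rangle^{1/2}V\to 0,\qquad \langle x\rangle^{1/2}V_x\to 0,\qquad \langle y\rangle V_x\to 0\qquad\text{as } x^2+y^2\to\infty .$$ If $\psi\in D(H)$, $\psi\neq 0$, is an eigenfunction of $H$, that is, $H\psi=\lambda\psi$ for some $\lambda\in\mathbb C$, then the distribution $D_x\psi$ belongs to $L^2(\mathbb R^2)$. -/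

import Mathlib

open MeasureTheory Filter Topology
open scoped ContDiff SchwartzMap LineDeriv InnerProductSpace

noncomputable section

namespace MagneticStark

/-- The Hilbert space `L²(ℝ²)` of complex-valued functions; points of the plane are pairs `(x, y)`. -/
abbrev L2 : Type := Lp ℂ 2 (volume : Measure (ℝ × ℝ))

/-- The space `C₀^∞(ℝ²)` of complex-valued smooth functions with compact support. -/
def TestFun : Submodule ℂ (ℝ × ℝ → ℂ) where
  carrier := {f | ContDiff ℝ ∞ f ∧ HasCompactSupport f}
  add_mem' hf hg := ⟨hf.1.add hg.1, hf.2.add hg.2⟩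
  zero_mem' := ⟨contDiff_const, HasCompactSupport.zero⟩
  smul_mem' c _ hf := ⟨hf.1.const_smul c, hf.2.smul_left (f := fun _ => c)⟩

/-- The operator `-i ∂_v` on `C₀^∞(ℝ²)`. -/
def momentum (v : ℝ × ℝ) : Module.End ℂ TestFun where
  toFun f := ⟨fun p => -Complex.I * fderiv ℝ f.1 p v,
    contDiff_const.mul
      ((f.2.1.fderiv_right (m := ∞) (by norm_cast)).clm_apply contDiff_const),
    (f.2.2.fderiv_apply (𝕜 := ℝ) v).mul_left⟩
  map_add' f g := by
    ext p
    have hf : DifferentiableAt ℝ f.1 p := f.2.1.differentiable (by simp) p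
    have hg : DifferentiableAt ℝ g.1 p := g.2.1.differentiable (by simp) p
    have h : fderiv ℝ (f.1 + g.1) p = fderiv ℝ f.1 p + fderiv ℝ g.1 p := fderiv_add hf hg
    simp [h, mul_add]
  map_smul' c f := by
    ext p
    have hf : DifferentiableAt ℝ f.1 p := f.2.1.differentiable (by simp) p
    have h : fderiv ℝ (c • f.1) p = c • fderiv ℝ f.1 p := fderiv_const_smul hf c
    simp [h, mul_left_comm]

/-- Multiplication by a smooth real function on `C₀^∞(ℝ²)`. -/
def mulTest (a : ℝ × ℝ → ℝ) (ha : ContDiff ℝ ∞ a) : Module.End ℂ TestFun where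
  toFun f := ⟨fun p => (a p : ℂ) * f.1 p,
    (Complex.ofRealCLM.contDiff.comp ha).mul f.2.1, f.2.2.mul_left⟩
  map_add' f g := by
    ext p
    simp [mul_add]
  map_smul' c f := by
    ext p
    simp [mul_left_comm]

/-- `D_x = -i ∂_x` on test functions. -/
def Dx : Module.End ℂ TestFun := momentum (1, 0)

/-- `D_y = -i ∂_y` on test functions. -/
def Dy : Module.End ℂ TestFun := momentum (0, 1)

/-- Multiplication by the coordinate `x` on test functions. -/
def coordX : Module.End ℂ TestFun := mulTest Prod.fst contDiff_fst

/-- Multiplication by the coordinate `y` on test functions. -/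
def coordY : Module.End ℂ TestFun := mulTest Prod.snd contDiff_snd

/-- The differential expression `(D_x + y)² + D_y² + x` on `C₀^∞(ℝ²)`. -/
def freeExpr : Module.End ℂ TestFun := (Dx + coordY) ^ 2 + Dy ^ 2 + coordX

theorem memLp_test (f : TestFun) : MemLp f.1 2 (volume : Measure (ℝ × ℝ)) :=
  f.2.1.continuous.memLp_of_hasCompactSupport f.2.2

/-- The embedding `C₀^∞(ℝ²) → L²(ℝ²)`. -/
def testToL2 : TestFun →ₗ[ℂ] L2 where
  toFun f := (memLp_test f).toLp f.1
  map_add' f g := MemLp.toLp_add (memLp_test f) (memLp_test g)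
  map_smul' c f := MemLp.toLp_const_smul c (memLp_test f)

theorem testToL2_injective : Function.Injective testToL2 := by
  intro f g h
  have h1 : f.1 =ᵐ[volume] g.1 := (MemLp.toLp_eq_toLp_iff (memLp_test f) (memLp_test g)).1 h
  exact Subtype.ext ((Continuous.ae_eq_iff_eq volume f.2.1.continuous g.2.1.continuous).1 h1)

/-- `(D_x + y)² + D_y² + x` as an unbounded operator in `L²(ℝ²)` with domain `C₀^∞(ℝ²)`. -/
def H0min : L2 →ₗ.[ℂ] L2 where
  domain := LinearMap.range testToL2
  toFun := (testToL2 ∘ₗ freeExpr) ∘ₗ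
    (LinearEquiv.ofInjective testToL2 testToL2_injective).symm.toLinearMap

theorem inner_testToL2 (f g : TestFun) :
    ⟪testToL2 f, testToL2 g⟫_ℂ = ∫ p : ℝ × ℝ, (starRingEnd ℂ) (f.1 p) * g.1 p := by
  rw [L2.inner_def]
  refine integral_congr_ae ?_
  filter_upwards [(memLp_test f).coeFn_toLp, (memLp_test g).coeFn_toLp] with p hf hg
  change ⟪((memLp_test f).toLp f.1 : ℝ × ℝ → ℂ) p, ((memLp_test g).toLp g.1 : ℝ × ℝ → ℂ) p⟫_ℂ = _
  rw [hf, hg, RCLike.inner_apply, mul_comm]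

/-- Formal self-adjointness of an operator on test functions. -/
def IsSymmTest (A : Module.End ℂ TestFun) : Prop :=
  ∀ f g : TestFun, ⟪testToL2 (A f), testToL2 g⟫_ℂ = ⟪testToL2 f, testToL2 (A g)⟫_ℂ

theorem IsSymmTest.add {A B : Module.End ℂ TestFun} (hA : IsSymmTest A) (hB : IsSymmTest B) :
    IsSymmTest (A + B) := by
  intro f g
  simp [inner_add_left, inner_add_right, hA f g, hB f g]

theorem IsSymmTest.sq {A : Module.End ℂ TestFun} (hA : IsSymmTest A) : IsSymmTest (A ^ 2) := by
  intro f g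
  rw [pow_two, Module.End.mul_apply, Module.End.mul_apply, hA, hA]

theorem isSymmTest_mulTest (a : ℝ × ℝ → ℝ) (ha : ContDiff ℝ ∞ a) :
    IsSymmTest (mulTest a ha) := by
  intro f g
  rw [inner_testToL2, inner_testToL2]
  congr 1
  ext p
  simp only [mulTest, LinearMap.coe_mk, AddHom.coe_mk, map_mul, Complex.conj_ofReal]
  ring

theorem isSymmTest_momentum (v : ℝ × ℝ) : IsSymmTest (momentum v) := by
  intro f g
  rw [inner_testToL2, inner_testToL2]
  have hfc : ContDiff ℝ ∞ (fun p => (starRingEnd ℂ) (f.1 p)) :=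
    Complex.conjCLE.contDiff.comp f.2.1
  have hfs : HasCompactSupport (fun p => (starRingEnd ℂ) (f.1 p)) :=
    f.2.2.comp_left (map_zero (starRingEnd ℂ))
  have hd : ∀ p, fderiv ℝ (fun p => (starRingEnd ℂ) (f.1 p)) p v
      = (starRingEnd ℂ) (fderiv ℝ f.1 p v) := by
    intro p
    have h1 : HasFDerivAt f.1 (fderiv ℝ f.1 p) p :=
      (f.2.1.differentiable (by simp) p).hasFDerivAt
    have h2 := (Complex.conjCLE.toContinuousLinearMap.hasFDerivAt (x := f.1 p)).comp p h1
    have h3 : fderiv ℝ (fun p => (starRingEnd ℂ) (f.1 p)) p = _ := h2.fderiv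
    rw [h3]
    rfl
  have hF' : Continuous (fun p => fderiv ℝ (fun p => (starRingEnd ℂ) (f.1 p)) p v) :=
    (hfc.continuous_fderiv (by simp)).clm_apply continuous_const
  have hG' : Continuous (fun p => fderiv ℝ g.1 p v) :=
    (g.2.1.continuous_fderiv (by simp)).clm_apply continuous_const
  have key := integral_mul_fderiv_eq_neg_fderiv_mul_of_integrable (μ := volume)
    (f := fun p => (starRingEnd ℂ) (f.1 p)) (g := g.1) (v := v)
    ((hF'.mul g.2.1.continuous).integrable_of_hasCompactSupport g.2.2.mul_left)
    ((hfc.continuous.mul hG').integrable_of_hasCompactSupport hfs.mul_right)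
    ((hfc.continuous.mul g.2.1.continuous).integrable_of_hasCompactSupport hfs.mul_right)
    (fun p _ => hfc.differentiable (by simp) p)
    (fun p _ => g.2.1.differentiable (by simp) p)
  have hL : (fun p => (starRingEnd ℂ) ((momentum v f).1 p) * g.1 p)
      = fun p => Complex.I * (fderiv ℝ (fun p => (starRingEnd ℂ) (f.1 p)) p v * g.1 p) := by
    ext p
    simp [momentum, hd p, mul_assoc]
  have hR : (fun p => (starRingEnd ℂ) (f.1 p) * (momentum v g).1 p)
      = fun p => -Complex.I * ((starRingEnd ℂ) (f.1 p) * fderiv ℝ g.1 p v) := by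
    ext p
    simp [momentum, mul_left_comm]
  rw [hL, hR, integral_const_mul, integral_const_mul, key]
  ring

theorem isSymmTest_freeExpr : IsSymmTest freeExpr :=
  (((isSymmTest_momentum _).add (isSymmTest_mulTest _ _)).sq.add
    (isSymmTest_momentum _).sq).add (isSymmTest_mulTest _ _)

theorem dense_H0min_domain : Dense (H0min.domain : Set L2) := by
  refine (Lp.dense_hasCompactSupport_contDiff (F := ℂ) (μ := (volume : Measure (ℝ × ℝ)))
    (p := 2) (by simp)).mono ?_
  rintro u ⟨f, hfu, hfs, hfc⟩
  exact ⟨⟨f, hfc, hfs⟩, Lp.ext ((memLp_test ⟨f, hfc, hfs⟩).coeFn_toLp.trans hfu.symm)⟩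

theorem H0min_testToL2 (f : TestFun) (h : testToL2 f ∈ H0min.domain) :
    H0min ⟨testToL2 f, h⟩ = testToL2 (freeExpr f) := by
  have : (LinearEquiv.ofInjective testToL2 testToL2_injective).symm ⟨testToL2 f, h⟩ = f := by
    rw [LinearEquiv.symm_apply_eq]
    rfl
  change testToL2 (freeExpr
    ((LinearEquiv.ofInjective testToL2 testToL2_injective).symm ⟨testToL2 f, h⟩)) = _
  rw [this]

theorem H0min_isClosable : H0min.IsClosable := by
  have hs : H0min.IsFormalAdjoint H0min := by
    rintro ⟨u, hu⟩ ⟨w, hw⟩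
    obtain ⟨f, rfl⟩ : ∃ f, testToL2 f = u := hu
    obtain ⟨g, rfl⟩ : ∃ g, testToL2 g = w := hw
    exact (congrArg (fun z => ⟪z, testToL2 g⟫_ℂ) (H0min_testToL2 f ⟨f, rfl⟩)).trans
      ((isSymmTest_freeExpr f g).trans
        (congrArg (fun z => ⟪testToL2 f, z⟫_ℂ) (H0min_testToL2 g ⟨g, rfl⟩)).symm)
  exact (LinearPMap.adjoint_isClosed dense_H0min_domain).isClosable.leIsClosable
    (hs.le_adjoint dense_H0min_domain)

/-- The free Hamiltonian `H₀ = (D_x + y)² + D_y² + x`: the closure of its restriction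
to `C₀^∞(ℝ²)` (which is closable by `H0min_isClosable`). -/
def H0 : L2 →ₗ.[ℂ] L2 := H0min.closure

/-- Multiplication by the real function `V` in `L²(ℝ²)`, on its natural domain
`{u ∈ L² : V u ∈ L²}` (which is all of `L²` when `V` is bounded and measurable). -/
def mulOp (V : ℝ × ℝ → ℝ) : L2 →ₗ.[ℂ] L2 where
  domain :=
    { carrier := {u | MemLp (fun p => (V p : ℂ) * u p) 2 volume}
      add_mem' := by
        intro u w hu hw
        refine (memLp_congr_ae ?_).2 (MemLp.add hu hw)
        filter_upwards [Lp.coeFn_add u w] with p hp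
        rw [hp, Pi.add_apply, Pi.add_apply, mul_add]
      zero_mem' := by
        refine (memLp_congr_ae ?_).2 (MemLp.zero (ε := ℂ))
        filter_upwards [Lp.coeFn_zero ℂ 2 (volume : Measure (ℝ × ℝ))] with p hp
        rw [hp, Pi.zero_apply, mul_zero]
      smul_mem' := by
        intro c u hu
        refine (memLp_congr_ae ?_).2 (MemLp.const_smul hu c)
        filter_upwards [Lp.coeFn_smul c u] with p hp
        simp [hp, mul_left_comm] }
  toFun :=
    { toFun := fun u => MemLp.toLp (fun p => (V p : ℂ) * u.1 p) u.2
      map_add' := by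
        intro u w
        rw [← MemLp.toLp_add]
        refine MemLp.toLp_congr _ _ ?_
        filter_upwards [Lp.coeFn_add u.1 w.1] with p hp
        rw [Submodule.coe_add, hp, Pi.add_apply, Pi.add_apply, mul_add]
      map_smul' := by
        intro c u
        rw [RingHom.id_apply, ← MemLp.toLp_const_smul]
        refine MemLp.toLp_congr _ _ ?_
        filter_upwards [Lp.coeFn_smul c u.1] with p hp
        simp [hp, mul_left_comm] }

/-- The magnetic Stark Hamiltonian `H = H₀ + V`. The sum of unbounded operators is defined on
the intersection of the domains, so `D(H) = D(H₀)` for bounded measurable `V`. -/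
def H (V : ℝ × ℝ → ℝ) : L2 →ₗ.[ℂ] L2 := H0 + mulOp V

/-- `ψ` is an eigenfunction of the unbounded operator `A` with eigenvalue `μ`. -/
def IsEigenfunction (A : L2 →ₗ.[ℂ] L2) (μ : ℂ) (ψ : L2) : Prop :=
  ψ ≠ 0 ∧ ∃ h : ψ ∈ A.domain, A ⟨ψ, h⟩ = μ • ψ

/-- `D_x ψ ∈ L²(ℝ²)`: the distribution `-i ∂_x ψ` is given by a square integrable function. -/
def DxMemL2 (ψ : L2) : Prop :=
  ∃ g : L2, -Complex.I • ∂_{((1 : ℝ), (0 : ℝ))} (Lp.toTemperedDistribution ψ) =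
    Lp.toTemperedDistribution g

/-- The Japanese bracket `⟨t⟩ = (1 + t²)^{1/2}`. -/
def bracket (t : ℝ) : ℝ := Real.sqrt (1 + t ^ 2)

end MagneticStark

end

open scoped BoundedContinuousFunction

noncomputable section

namespace MagneticStark

/-! Write `T_h` for translation by `h` in `x`, `W` for the potential, `Q = ∂_x W`, and `D(h) = ‖T_h
ψ - ψ‖`. The aim is `D(h) = O(h)`; Riesz representation then turns bounded difference quotients into
`D_x ψ ∈ L²`.

Only the Stark term `x` fails to commute with `T_h`, so `H₀ T_h = T_h H₀ - h T_h`. Pairing the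
eigenvalue equation with `T_h ψ` and dividing by `h` gives a finite-difference virial identity for
`⟪ψ, T_h ψ⟫` in which only `Q` appears (`virial`, `inner_trans_self_eq_integral`). At `h = 0` it
reads `‖ψ‖² = -⟪ψ, Q ψ⟫`. Hence `D(h)² = 2(‖ψ‖² - Re ⟪ψ, T_h ψ⟫)` is an average of differences of
`Q`-forms in translates of `ψ`. After symmetrization these contain only second differences `Q (T_a +
T_{-a} - 2) ψ` and products of two first differences.

Both are small because `Q D_x` is bounded relative to `H₀` (`norm_mulBdd_Dx_le`): a weighted energy
estimate controls `⟨x⟩^{-1/2} (D_x + y)`, and `Q y` is bounded. So `Q (T_a - 1)` costs a factor `a`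
times the graph norm. A second difference is `(T_a - 1)` applied to `(1 - T_{-a}) ψ`, whose graph
norm is `O(D(a) + a)`. Altogether `D(h)² ≤ L h (h + max_{[0,h]} D)`, and evaluating at a maximum
point yields `D(h) ≤ (L + 1) h`. -/

/-! ### Translations in the `x` variable -/

/-- The translation `(trans h u) (x, y) = u (x + h, y)` on `L²(ℝ²)`. -/
def trans (h : ℝ) : L2 →ₗᵢ[ℂ] L2 :=
  Lp.compMeasurePreservingₗᵢ ℂ (fun p : ℝ × ℝ => p + (h, 0))
    (measurePreserving_add_right volume ((h, 0) : ℝ × ℝ))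

theorem coeFn_trans (h : ℝ) (u : L2) :
    (trans h u : ℝ × ℝ → ℂ) =ᵐ[volume] fun p => u (p + (h, 0)) :=
  Lp.coeFn_compMeasurePreserving u (measurePreserving_add_right volume ((h, 0) : ℝ × ℝ))

theorem ae_comp_add {P : ℝ × ℝ → Prop} (hP : ∀ᵐ p : ℝ × ℝ, P p) (v : ℝ × ℝ) :
    ∀ᵐ p : ℝ × ℝ, P (p + v) :=
  (measurePreserving_add_right volume v).quasiMeasurePreserving.ae hP

theorem trans_trans (h k : ℝ) (u : L2) : trans h (trans k u) = trans (h + k) u := by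
  refine Lp.ext ?_
  filter_upwards [coeFn_trans h (trans k u), coeFn_trans (h + k) u,
    ae_comp_add (coeFn_trans k u) (h, 0)] with p h1 h2 h3
  rw [h1, h2, h3, add_assoc]
  simp

@[simp]
theorem trans_zero (u : L2) : trans 0 u = u := by
  refine Lp.ext ?_
  filter_upwards [coeFn_trans 0 u] with p h1
  rw [h1, Prod.mk_zero_zero, add_zero]

@[simp]
theorem norm_trans (h : ℝ) (u : L2) : ‖trans h u‖ = ‖u‖ := (trans h).norm_map u

theorem inner_trans_left (h : ℝ) (u w : L2) : ⟪trans h u, w⟫_ℂ = ⟪u, trans (-h) w⟫_ℂ := by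
  rw [← (trans (-h)).inner_map_map (trans h u) w, trans_trans, neg_add_cancel, trans_zero]

theorem inner_trans_right (h : ℝ) (u w : L2) : ⟪u, trans h w⟫_ℂ = ⟪trans (-h) u, w⟫_ℂ := by
  rw [inner_trans_left, neg_neg]

theorem continuous_trans (u : L2) : Continuous fun h : ℝ => trans h u := by
  have hg : Continuous fun h : ℝ =>
      (⟨fun p : ℝ × ℝ => p + (h, 0), by fun_prop⟩ : C(ℝ × ℝ, ℝ × ℝ)) :=
    ContinuousMap.continuous_of_continuous_uncurry _ (by
      change Continuous fun q : ℝ × (ℝ × ℝ) => q.2 + (q.1, (0 : ℝ))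
      fun_prop)
  exact (continuous_const (y := u)).compMeasurePreservingLp hg
    (fun h => measurePreserving_add_right volume ((h, 0) : ℝ × ℝ)) (by simp)

theorem norm_trans_neg_sub (h : ℝ) (u : L2) : ‖trans (-h) u - u‖ = ‖trans h u - u‖ := by
  rw [← norm_trans h (trans (-h) u - u), map_sub, trans_trans, add_neg_cancel, trans_zero,
    norm_sub_rev]

/-! ### Multiplication by bounded continuous functions -/

theorem memLp_mul (W : (ℝ × ℝ) →ᵇ ℝ) (u : L2) :
    MemLp (fun p => (W p : ℂ) * u p) 2 (volume : Measure (ℝ × ℝ)) :=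
  (Lp.memLp u).of_le_mul (c := ‖W‖)
    ((Complex.continuous_ofReal.comp W.continuous).aestronglyMeasurable.mul
      (Lp.aestronglyMeasurable u))
    (ae_of_all _ fun p => by
      rw [norm_mul, Complex.norm_real]
      exact mul_le_mul_of_nonneg_right (W.norm_coe_le_norm p) (norm_nonneg _))

/-- Multiplication by a bounded continuous real function on `L²(ℝ²)`. -/
def mulBdd (W : (ℝ × ℝ) →ᵇ ℝ) : L2 →L[ℂ] L2 :=
  LinearMap.mkContinuous
    { toFun := fun u => (memLp_mul W u).toLp _
      map_add' := fun u w => by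
        rw [← MemLp.toLp_add]
        refine MemLp.toLp_congr _ _ ?_
        filter_upwards [Lp.coeFn_add u w] with p hp
        rw [hp, Pi.add_apply, Pi.add_apply, mul_add]
      map_smul' := fun c u => by
        rw [RingHom.id_apply, ← MemLp.toLp_const_smul]
        refine MemLp.toLp_congr _ _ ?_
        filter_upwards [Lp.coeFn_smul c u] with p hp
        simp [hp, mul_left_comm] }
    ‖W‖ fun u => by
      refine Lp.norm_le_mul_norm_of_ae_le_mul ?_
      filter_upwards [(memLp_mul W u).coeFn_toLp] with p hp
      change ‖((memLp_mul W u).toLp _ : ℝ × ℝ → ℂ) p‖ ≤ _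
      rw [hp, norm_mul, Complex.norm_real]
      exact mul_le_mul_of_nonneg_right (W.norm_coe_le_norm p) (norm_nonneg _)

theorem coeFn_mulBdd (W : (ℝ × ℝ) →ᵇ ℝ) (u : L2) :
    (mulBdd W u : ℝ × ℝ → ℂ) =ᵐ[volume] fun p => (W p : ℂ) * u p :=
  (memLp_mul W u).coeFn_toLp

theorem norm_mulBdd_le_of_forall {W : (ℝ × ℝ) →ᵇ ℝ} {C : ℝ} (hC : ∀ p, |W p| ≤ C) (u : L2) :
    ‖mulBdd W u‖ ≤ C * ‖u‖ := by
  refine Lp.norm_le_mul_norm_of_ae_le_mul ?_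
  filter_upwards [coeFn_mulBdd W u] with p hp
  rw [hp, norm_mul, Complex.norm_real]
  exact mul_le_mul_of_nonneg_right (hC p) (norm_nonneg _)

theorem inner_mulBdd_left (W : (ℝ × ℝ) →ᵇ ℝ) (u w : L2) :
    ⟪mulBdd W u, w⟫_ℂ = ⟪u, mulBdd W w⟫_ℂ := by
  rw [L2.inner_def, L2.inner_def]
  refine integral_congr_ae ?_
  filter_upwards [coeFn_mulBdd W u, coeFn_mulBdd W w] with p h1 h2
  rw [h1, h2, RCLike.inner_apply, RCLike.inner_apply, map_mul, Complex.conj_ofReal]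
  ring

/-- The translate `(x, y) ↦ W (x + h, y)` of a bounded continuous function. -/
def transBdd (h : ℝ) (W : (ℝ × ℝ) →ᵇ ℝ) : (ℝ × ℝ) →ᵇ ℝ :=
  W.compContinuous ⟨fun p => p + (h, 0), by fun_prop⟩

@[simp]
theorem transBdd_apply (h : ℝ) (W : (ℝ × ℝ) →ᵇ ℝ) (p : ℝ × ℝ) :
    transBdd h W p = W (p + (h, 0)) := rfl

theorem trans_mulBdd (h : ℝ) (W : (ℝ × ℝ) →ᵇ ℝ) (u : L2) :
    trans h (mulBdd W u) = mulBdd (transBdd h W) (trans h u) := by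
  refine Lp.ext ?_
  filter_upwards [coeFn_trans h (mulBdd W u), coeFn_mulBdd (transBdd h W) (trans h u),
    coeFn_trans h u, ae_comp_add (coeFn_mulBdd W u) (h, 0)] with p h1 h2 h3 h4
  rw [h1, h2, h3, h4, transBdd_apply]

theorem mulBdd_sub (W Z : (ℝ × ℝ) →ᵇ ℝ) (u : L2) :
    mulBdd (W - Z) u = mulBdd W u - mulBdd Z u := by
  refine Lp.ext ?_
  filter_upwards [coeFn_mulBdd (W - Z) u, coeFn_mulBdd W u, coeFn_mulBdd Z u,
    Lp.coeFn_sub (mulBdd W u) (mulBdd Z u)] with p h1 h2 h3 h4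
  rw [h1, h4, Pi.sub_apply, h2, h3, BoundedContinuousFunction.sub_apply, Complex.ofReal_sub,
    sub_mul]

/-! ### Integration of translates -/

theorem coeFn_trans_toLp {w : ℝ × ℝ → ℂ} (hw : MemLp w 2 (volume : Measure (ℝ × ℝ))) (h : ℝ) :
    (trans h (hw.toLp w) : ℝ × ℝ → ℂ) =ᵐ[volume] fun p => w (p + (h, 0)) := by
  filter_upwards [coeFn_trans h (hw.toLp w), ae_comp_add hw.coeFn_toLp (h, 0)] with p h1 h2
  rw [h1, h2]

theorem inner_trans_toLp (φ : L2) {w : ℝ × ℝ → ℂ}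
    (hw : MemLp w 2 (volume : Measure (ℝ × ℝ))) (h : ℝ) :
    ⟪φ, trans h (hw.toLp w)⟫_ℂ = ∫ p : ℝ × ℝ, (starRingEnd ℂ) (φ p) * w (p + (h, 0)) := by
  rw [L2.inner_def]
  refine integral_congr_ae ?_
  filter_upwards [coeFn_trans_toLp hw h] with p h1
  rw [h1, RCLike.inner_apply, mul_comm]

theorem integrable_mul_translate (φ : L2) {w : ℝ × ℝ → ℂ}
    (hw : MemLp w 2 (volume : Measure (ℝ × ℝ))) (h : ℝ) :
    Integrable (fun p : ℝ × ℝ => (starRingEnd ℂ) (φ p) * w (p + (h, 0))) := by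
  refine (L2.integrable_inner (𝕜 := ℂ) φ (trans h (hw.toLp w))).congr ?_
  filter_upwards [coeFn_trans_toLp hw h] with p h1
  rw [h1, RCLike.inner_apply, mul_comm]

/-- Justifies Fubini. The integrand is dominated by `|φ|² + |w(· + s)|²`, whose integral does not
depend on `s` by translation invariance. -/
theorem integrable_uncurry_mul_translate (φ : L2) {w : ℝ × ℝ → ℂ} (hwc : Continuous w)
    (hw : MemLp w 2 (volume : Measure (ℝ × ℝ))) (a b : ℝ) :
    Integrable (Function.uncurry fun (s : ℝ) (p : ℝ × ℝ) =>
      (starRingEnd ℂ) (φ p) * w (p + (s, 0)))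
      ((volume.restrict (Set.uIoc a b)).prod (volume : Measure (ℝ × ℝ))) := by
  have hmeas : AEStronglyMeasurable (Function.uncurry fun (s : ℝ) (p : ℝ × ℝ) =>
      (starRingEnd ℂ) (φ p) * w (p + (s, 0)))
      ((volume.restrict (Set.uIoc a b)).prod (volume : Measure (ℝ × ℝ))) := by
    refine AEStronglyMeasurable.mul ?_ ?_
    · exact (Complex.continuous_conj.comp_aestronglyMeasurable
        (Lp.aestronglyMeasurable φ)).comp_snd
    · exact (hwc.comp (by fun_prop : Continuous fun q : ℝ × (ℝ × ℝ) =>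
        q.2 + (q.1, (0 : ℝ)))).aestronglyMeasurable
  refine (integrable_prod_iff hmeas).2 ⟨ae_of_all _ fun s => integrable_mul_translate φ hw s, ?_⟩
  have : IsFiniteMeasure (volume.restrict (Set.uIoc a b)) :=
    inferInstanceAs (IsFiniteMeasure (volume.restrict (Set.Ioc (min a b) (max a b))))
  refine Integrable.of_bound (C := ∫ p : ℝ × ℝ, (‖φ p‖ ^ 2 + ‖w p‖ ^ 2))
    hmeas.norm.integral_prod_right' (ae_of_all _ fun s => ?_)
  have h1 : Integrable (fun p : ℝ × ℝ => ‖φ p‖ ^ 2) := (Lp.memLp φ).integrable_norm_pow (by simp)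
  have h2 : Integrable (fun p : ℝ × ℝ => ‖w p‖ ^ 2) := hw.integrable_norm_pow (by simp)
  have h3 : Integrable (fun p : ℝ × ℝ => ‖w (p + (s, 0))‖ ^ 2) := h2.comp_add_right (s, 0)
  rw [Real.norm_of_nonneg (integral_nonneg fun p => norm_nonneg _), integral_add h1 h2,
    ← integral_add_right_eq_self (fun p : ℝ × ℝ => ‖w p‖ ^ 2) (s, 0), ← integral_add h1 h3]
  refine integral_mono (integrable_mul_translate φ hw s).norm (h1.add h3) fun p => ?_
  simp only [Function.uncurry, norm_mul, RCLike.norm_conj]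
  nlinarith [sq_nonneg (‖φ p‖ - ‖w (p + (s, 0))‖), sq_nonneg ‖φ p‖,
    sq_nonneg ‖w (p + (s, 0))‖]

/-- The fundamental theorem of calculus for translates, tested against a square integrable
function. -/
theorem inner_trans_sub_eq_integral (φ : L2) {u w : ℝ × ℝ → ℂ}
    (hu : MemLp u 2 (volume : Measure (ℝ × ℝ))) (hw : MemLp w 2 (volume : Measure (ℝ × ℝ)))
    (hwc : Continuous w)
    (hd : ∀ (p : ℝ × ℝ) (t : ℝ), HasDerivAt (fun s : ℝ => u (p + (s, 0))) (w (p + (t, 0))) t)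
    (b : ℝ) :
    ⟪φ, trans b (hu.toLp u) - hu.toLp u⟫_ℂ = ∫ s in (0 : ℝ)..b, ⟪φ, trans s (hw.toLp w)⟫_ℂ := by
  simp_rw [inner_trans_toLp]
  rw [intervalIntegral_integral_swap (integrable_uncurry_mul_translate φ hwc hw 0 b),
    inner_sub_right, inner_trans_toLp]
  conv_lhs => rw [← trans_zero (hu.toLp u), inner_trans_toLp]
  rw [← integral_sub (integrable_mul_translate φ hu b) (integrable_mul_translate φ hu 0)]
  congr 1
  ext p
  rw [intervalIntegral.integral_const_mul, intervalIntegral.integral_eq_sub_of_hasDerivAt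
    (fun t _ => hd p t) ((hwc.comp (by fun_prop)).intervalIntegrable 0 b), mul_sub]

/-! ### Operators on test functions -/

theorem norm_mulBdd_testToL2_le {W : (ℝ × ℝ) →ᵇ ℝ} {C : ℝ} {f g : TestFun}
    (h : ∀ p, |W p| * ‖f.1 p‖ ≤ C * ‖g.1 p‖) :
    ‖mulBdd W (testToL2 f)‖ ≤ C * ‖testToL2 g‖ := by
  refine Lp.norm_le_mul_norm_of_ae_le_mul ?_
  filter_upwards [coeFn_mulBdd W (testToL2 f), (memLp_test f).coeFn_toLp,
    (memLp_test g).coeFn_toLp] with p h1 h2 h3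
  rw [h1, norm_mul, Complex.norm_real]
  change |W p| * ‖((memLp_test f).toLp f.1 : ℝ × ℝ → ℂ) p‖
    ≤ C * ‖((memLp_test g).toLp g.1 : ℝ × ℝ → ℂ) p‖
  rw [h2, h3]
  exact h p

theorem norm_testToL2_le {f g : TestFun} (h : ∀ p, ‖f.1 p‖ ≤ ‖g.1 p‖) :
    ‖testToL2 f‖ ≤ ‖testToL2 g‖ := by
  refine Lp.norm_le_norm_of_ae_le ?_
  filter_upwards [(memLp_test f).coeFn_toLp, (memLp_test g).coeFn_toLp] with p h2 h3
  change ‖((memLp_test f).toLp f.1 : ℝ × ℝ → ℂ) p‖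
    ≤ ‖((memLp_test g).toLp g.1 : ℝ × ℝ → ℂ) p‖
  rw [h2, h3]
  exact h p

theorem mulTest_apply (a : ℝ × ℝ → ℝ) (ha : ContDiff ℝ ∞ a) (f : TestFun) (p : ℝ × ℝ) :
    (mulTest a ha f).1 p = (a p : ℂ) * f.1 p := rfl

theorem momentum_apply (v : ℝ × ℝ) (f : TestFun) (p : ℝ × ℝ) :
    (momentum v f).1 p = -Complex.I * fderiv ℝ f.1 p v := rfl

theorem contDiff_fderiv_apply {a : ℝ × ℝ → ℝ} (ha : ContDiff ℝ ∞ a) (v : ℝ × ℝ) :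
    ContDiff ℝ ∞ fun p => fderiv ℝ a p v :=
  (ha.fderiv_right (m := ∞) (by norm_cast)).clm_apply contDiff_const

theorem momentum_mulTest (v : ℝ × ℝ) (a : ℝ × ℝ → ℝ) (ha : ContDiff ℝ ∞ a) (f : TestFun) :
    momentum v (mulTest a ha f) = mulTest a ha (momentum v f)
      + (-Complex.I) • mulTest (fun p => fderiv ℝ a p v) (contDiff_fderiv_apply ha v) f := by
  ext p
  have h1 : HasFDerivAt a (fderiv ℝ a p) p := (ha.differentiable (by simp) p).hasFDerivAt
  have h2 : HasFDerivAt f.1 (fderiv ℝ f.1 p) p := (f.2.1.differentiable (by simp) p).hasFDerivAt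
  have h3 := (Complex.ofRealCLM.hasFDerivAt.comp p h1).mul h2
  have h4 : fderiv ℝ (mulTest a ha f).1 p = _ := h3.fderiv
  rw [momentum_apply, h4]
  simp [mulTest_apply, momentum_apply]
  ring

/-- Translation in `x` on test functions. -/
def transTest (h : ℝ) : Module.End ℂ TestFun where
  toFun f := ⟨fun p => f.1 (p + (h, 0)), f.2.1.comp (contDiff_id.add contDiff_const),
    f.2.2.comp_homeomorph (Homeomorph.addRight ((h, 0) : ℝ × ℝ))⟩
  map_add' _ _ := rfl
  map_smul' _ _ := rfl

theorem transTest_apply (h : ℝ) (f : TestFun) (p : ℝ × ℝ) :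
    (transTest h f).1 p = f.1 (p + (h, 0)) := rfl

theorem trans_testToL2 (h : ℝ) (f : TestFun) :
    trans h (testToL2 f) = testToL2 (transTest h f) := by
  refine Lp.ext ?_
  exact (coeFn_trans_toLp (memLp_test f) h).trans (memLp_test (transTest h f)).coeFn_toLp.symm

theorem momentum_transTest (v : ℝ × ℝ) (h : ℝ) (f : TestFun) :
    momentum v (transTest h f) = transTest h (momentum v f) := by
  ext p
  have : fderiv ℝ (transTest h f).1 p = fderiv ℝ f.1 (p + (h, 0)) :=
    fderiv_comp_add_right (f := f.1) ((h, 0) : ℝ × ℝ)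
  rw [momentum_apply, this, transTest_apply, momentum_apply]

theorem coordY_transTest (h : ℝ) (f : TestFun) :
    coordY (transTest h f) = transTest h (coordY f) := by
  ext p
  simp [coordY, mulTest_apply, transTest_apply]

theorem coordX_transTest (h : ℝ) (f : TestFun) :
    coordX (transTest h f) = transTest h (coordX f) - (h : ℂ) • transTest h f := by
  ext p
  simp [coordX, mulTest_apply, transTest_apply]
  ring

/-- The momenta and `y` commute with translation in `x`; the coordinate `x` alone produces the term
`-h T_h`. The virial identity rests on this commutator. -/
theorem freeExpr_transTest (h : ℝ) (f : TestFun) :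
    freeExpr (transTest h f) = transTest h (freeExpr f) - (h : ℂ) • transTest h f := by
  simp only [freeExpr, pow_two, LinearMap.add_apply, Module.End.mul_apply, map_add, Dx, Dy,
    momentum_transTest, coordY_transTest, coordX_transTest]
  abel

/-! ### The weighted energy estimate on test functions -/

/-- The weight `⟨x⟩^{2r}`, that is `(1 + x²)^r`. -/
def weight (r : ℝ) (p : ℝ × ℝ) : ℝ := (1 + p.1 ^ 2) ^ r

theorem contDiff_weight (r : ℝ) : ContDiff ℝ ∞ (weight r) :=
  (contDiff_const.add (contDiff_fst.pow 2)).rpow_const_of_ne fun p => by positivity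

theorem hasFDerivAt_weight (r : ℝ) (p : ℝ × ℝ) :
    HasFDerivAt (weight r) ((r * (1 + p.1 ^ 2) ^ (r - 1)) •
      ((2 * p.1) • ContinuousLinearMap.fst ℝ ℝ ℝ)) p := by
  have h1 : HasFDerivAt (fun q : ℝ × ℝ => 1 + q.1 ^ 2)
      ((2 * p.1) • ContinuousLinearMap.fst ℝ ℝ ℝ) p := by
    have := (((hasFDerivAt_fst (𝕜 := ℝ) (E := ℝ) (F := ℝ) (p := p)).pow 2).const_add 1)
    simpa using this
  exact h1.rpow_const (Or.inl (by positivity))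

theorem abs_le_sqrt_one_add_sq (x : ℝ) : |x| ≤ (1 + x ^ 2) ^ (1 / 2 : ℝ) := by
  rw [← Real.sqrt_eq_rpow, ← Real.sqrt_sq_eq_abs]
  exact Real.sqrt_le_sqrt (by linarith)

/-- The derivative of `⟨x⟩⁻¹` is `O(⟨x⟩⁻²)`. The weaker bound `⟨x⟩^{-1/2}` suffices, and it makes
the commutator term below controllable by the weighted kinetic norm being estimated. -/
theorem abs_fderiv_weight_le (p : ℝ × ℝ) :
    |fderiv ℝ (weight (-(1 / 2))) p (1, 0)| ≤ weight (-(1 / 4)) p := by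
  have hb : (1 : ℝ) ≤ 1 + p.1 ^ 2 := by nlinarith [sq_nonneg p.1]
  have hpos : (0 : ℝ) < 1 + p.1 ^ 2 := by linarith
  rw [(hasFDerivAt_weight _ p).fderiv]
  simp only [smul_apply, ContinuousLinearMap.coe_fst', smul_eq_mul, mul_one]
  rw [show (-(1 / 2) * (1 + p.1 ^ 2) ^ (-(1 / 2) - 1 : ℝ)) * (2 * p.1)
    = -(p.1 * (1 + p.1 ^ 2) ^ (-(3 / 2) : ℝ)) by ring_nf, abs_neg, abs_mul,
    abs_of_pos (Real.rpow_pos_of_pos hpos _)]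
  calc |p.1| * (1 + p.1 ^ 2) ^ (-(3 / 2) : ℝ)
      ≤ (1 + p.1 ^ 2) ^ (1 / 2 : ℝ) * (1 + p.1 ^ 2) ^ (-(3 / 2) : ℝ) := by
        gcongr
        exact abs_le_sqrt_one_add_sq _
    _ = (1 + p.1 ^ 2) ^ (-1 : ℝ) := by
        rw [← Real.rpow_add hpos]
        norm_num
    _ ≤ weight (-(1 / 4)) p := Real.rpow_le_rpow_of_exponent_le hb (by norm_num)

theorem weight_nonneg (r : ℝ) (p : ℝ × ℝ) : 0 ≤ weight r p := by
  unfold weight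
  positivity

theorem weight_le_one {r : ℝ} (hr : r ≤ 0) (p : ℝ × ℝ) : weight r p ≤ 1 :=
  Real.rpow_le_one_of_one_le_of_nonpos (by nlinarith [sq_nonneg p.1]) hr

theorem weight_mul_abs_le_one (p : ℝ × ℝ) : weight (-(1 / 2)) p * |p.1| ≤ 1 := by
  have hpos : (0 : ℝ) < 1 + p.1 ^ 2 := by positivity
  calc weight (-(1 / 2)) p * |p.1|
      ≤ (1 + p.1 ^ 2) ^ (-(1 / 2) : ℝ) * (1 + p.1 ^ 2) ^ (1 / 2 : ℝ) :=
        mul_le_mul_of_nonneg_left (abs_le_sqrt_one_add_sq _) (weight_nonneg _ p)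
    _ = 1 := by
        rw [← Real.rpow_add hpos]
        norm_num

theorem weight_quarter_mul_self (p : ℝ × ℝ) :
    weight (-(1 / 4)) p * weight (-(1 / 4)) p = weight (-(1 / 2)) p := by
  have hpos : (0 : ℝ) < 1 + p.1 ^ 2 := by positivity
  unfold weight
  rw [← Real.rpow_add hpos]
  norm_num

/-- Multiplication by `⟨x⟩^{2r}` on test functions. -/
def mulWeight (r : ℝ) : Module.End ℂ TestFun := mulTest (weight r) (contDiff_weight r)

theorem mulWeight_apply (r : ℝ) (f : TestFun) (p : ℝ × ℝ) :
    (mulWeight r f).1 p = (weight r p : ℂ) * f.1 p := rfl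

theorem mulWeight_quarter_twice (f : TestFun) :
    mulWeight (-(1 / 4)) (mulWeight (-(1 / 4)) f) = mulWeight (-(1 / 2)) f := by
  ext p
  rw [mulWeight_apply, mulWeight_apply, mulWeight_apply, ← weight_quarter_mul_self]
  push_cast
  ring

theorem norm_sq_mulWeight_quarter (f : TestFun) :
    ((‖testToL2 (mulWeight (-(1 / 4)) f)‖ ^ 2 : ℝ) : ℂ)
      = ⟪testToL2 f, testToL2 (mulWeight (-(1 / 2)) f)⟫_ℂ := by
  have h := isSymmTest_mulTest _ (contDiff_weight (-(1 / 4))) f (mulWeight (-(1 / 4)) f)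
  rw [← mulWeight_quarter_twice]
  change _ = ⟪testToL2 f, testToL2 (mulTest _ (contDiff_weight (-(1 / 4)))
    (mulWeight (-(1 / 4)) f))⟫_ℂ
  rw [← h]
  change _ = ⟪testToL2 (mulWeight (-(1 / 4)) f), testToL2 (mulWeight (-(1 / 4)) f)⟫_ℂ
  rw [inner_self_eq_norm_sq_to_K]
  norm_cast

/-- Multiplication by `∂_x ⟨x⟩⁻¹` on test functions. -/
def mulWeightDeriv : Module.End ℂ TestFun :=
  mulTest _ (contDiff_fderiv_apply (contDiff_weight (-(1 / 2))) (1, 0))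

theorem Dx_mulWeight (f : TestFun) :
    Dx (mulWeight (-(1 / 2)) f) = mulWeight (-(1 / 2)) (Dx f)
      + (-Complex.I) • mulWeightDeriv f :=
  momentum_mulTest _ _ _ f

theorem Dy_mulWeight (f : TestFun) :
    Dy (mulWeight (-(1 / 2)) f) = mulWeight (-(1 / 2)) (Dy f) := by
  refine (momentum_mulTest _ _ _ f).trans (add_eq_left.2 ?_)
  ext p
  simp [mulTest_apply, (hasFDerivAt_weight _ p).fderiv]

theorem coordY_mulWeight (r : ℝ) (f : TestFun) :
    coordY (mulWeight r f) = mulWeight r (coordY f) := by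
  ext p
  simp only [coordY, mulTest_apply, mulWeight_apply]
  ring

theorem norm_mulWeight_le {r : ℝ} (hr : r ≤ 0) (f : TestFun) :
    ‖testToL2 (mulWeight r f)‖ ≤ ‖testToL2 f‖ := by
  refine norm_testToL2_le fun p => ?_
  rw [mulWeight_apply, norm_mul, Complex.norm_real, Real.norm_of_nonneg (weight_nonneg r p)]
  exact mul_le_of_le_one_left (norm_nonneg _) (weight_le_one hr p)

theorem norm_mulWeight_coordX_le (f : TestFun) :
    ‖testToL2 (mulWeight (-(1 / 2)) (coordX f))‖ ≤ ‖testToL2 f‖ := by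
  refine norm_testToL2_le fun p => ?_
  rw [mulWeight_apply, coordX, mulTest_apply, ← mul_assoc, norm_mul, norm_mul, Complex.norm_real,
    Complex.norm_real, Real.norm_of_nonneg (weight_nonneg _ p)]
  exact mul_le_of_le_one_left (norm_nonneg _) (weight_mul_abs_le_one p)

theorem norm_mulWeightDeriv_le (f : TestFun) :
    ‖testToL2 (mulWeightDeriv f)‖ ≤ ‖testToL2 (mulWeight (-(1 / 4)) f)‖ := by
  refine norm_testToL2_le fun p => ?_
  rw [mulWeightDeriv, mulTest_apply, mulWeight_apply, norm_mul, norm_mul, Complex.norm_real,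
    Complex.norm_real, Real.norm_of_nonneg (weight_nonneg _ p)]
  exact mul_le_mul_of_nonneg_right (abs_fderiv_weight_le p) (norm_nonneg _)

/-- Move one factor `D_x + y` and one factor `D_y` across the inner product. The weight `⟨x⟩⁻¹`
commutes with `y` and `D_y`, so its commutator with `D_x` is the only error. -/
theorem norm_sq_weighted_energy (f : TestFun) :
    ((‖testToL2 (mulWeight (-(1 / 4)) ((Dx + coordY) f))‖ ^ 2
        + ‖testToL2 (mulWeight (-(1 / 4)) (Dy f))‖ ^ 2 : ℝ) : ℂ)
      = ⟪testToL2 f, testToL2 (mulWeight (-(1 / 2)) (freeExpr f))⟫_ℂ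
        - ⟪testToL2 f, testToL2 (mulWeight (-(1 / 2)) (coordX f))⟫_ℂ
        - Complex.I * ⟪testToL2 f, testToL2 (mulWeightDeriv ((Dx + coordY) f))⟫_ℂ := by
  have hp : IsSymmTest (Dx + coordY) := (isSymmTest_momentum _).add (isSymmTest_mulTest _ _)
  have hq : IsSymmTest Dy := isSymmTest_momentum _
  push_cast
  have h1 := norm_sq_mulWeight_quarter ((Dx + coordY) f)
  have h2 := norm_sq_mulWeight_quarter (Dy f)
  push_cast at h1 h2
  rw [h1, h2, hp, hq, Dy_mulWeight]
  have h3 : (Dx + coordY) (mulWeight (-(1 / 2)) ((Dx + coordY) f))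
      = mulWeight (-(1 / 2)) ((Dx + coordY) ((Dx + coordY) f))
        + (-Complex.I) • mulWeightDeriv ((Dx + coordY) f) := by
    rw [LinearMap.add_apply, Dx_mulWeight, coordY_mulWeight, LinearMap.add_apply, map_add]
    simp only [LinearMap.add_apply, map_add]
    module
  have h4 : freeExpr f = (Dx + coordY) ((Dx + coordY) f) + Dy (Dy f) + coordX f := by
    simp [freeExpr, pow_two]
  rw [h3, h4]
  simp only [map_add, map_smul, inner_add_right, inner_smul_right]
  ring

/-- The weight `⟨x⟩⁻¹` tames the unbounded term `x`, and the commutator term is linear in the left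
side `t`, so a quadratic inequality for `t` results. -/
theorem norm_weighted_kinetic_le (f : TestFun) :
    ‖testToL2 (mulWeight (-(1 / 4)) ((Dx + coordY) f))‖
      ≤ 2 * (‖testToL2 f‖ + ‖testToL2 (freeExpr f)‖) := by
  have key := congrArg norm (norm_sq_weighted_energy f)
  rw [Complex.norm_real, Real.norm_of_nonneg (by positivity)] at key
  have h1 := norm_inner_le_norm (𝕜 := ℂ) (testToL2 f)
    (testToL2 (mulWeight (-(1 / 2)) (freeExpr f)))
  have h2 := norm_inner_le_norm (𝕜 := ℂ) (testToL2 f)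
    (testToL2 (mulWeight (-(1 / 2)) (coordX f)))
  have h3 := norm_inner_le_norm (𝕜 := ℂ) (testToL2 f)
    (testToL2 (mulWeightDeriv ((Dx + coordY) f)))
  have h1' := mul_le_mul_of_nonneg_left
    (norm_mulWeight_le (by norm_num : (-(1 / 2) : ℝ) ≤ 0) (freeExpr f)) (norm_nonneg (testToL2 f))
  have h2' := mul_le_mul_of_nonneg_left (norm_mulWeight_coordX_le f) (norm_nonneg (testToL2 f))
  have h3' := mul_le_mul_of_nonneg_left (norm_mulWeightDeriv_le ((Dx + coordY) f))
    (norm_nonneg (testToL2 f))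
  have h4 : ‖Complex.I * ⟪testToL2 f, testToL2 (mulWeightDeriv ((Dx + coordY) f))⟫_ℂ‖
      = ‖⟪testToL2 f, testToL2 (mulWeightDeriv ((Dx + coordY) f))⟫_ℂ‖ := by simp
  have h5 := norm_sub_le (⟪testToL2 f, testToL2 (mulWeight (-(1 / 2)) (freeExpr f))⟫_ℂ
        - ⟪testToL2 f, testToL2 (mulWeight (-(1 / 2)) (coordX f))⟫_ℂ)
    (Complex.I * ⟪testToL2 f, testToL2 (mulWeightDeriv ((Dx + coordY) f))⟫_ℂ)
  have h6 := norm_sub_le ⟪testToL2 f, testToL2 (mulWeight (-(1 / 2)) (freeExpr f))⟫_ℂ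
    ⟪testToL2 f, testToL2 (mulWeight (-(1 / 2)) (coordX f))⟫_ℂ
  set t := ‖testToL2 (mulWeight (-(1 / 4)) ((Dx + coordY) f))‖
  have hU : 0 ≤ ‖testToL2 f‖ := norm_nonneg _
  have hH : 0 ≤ ‖testToL2 (freeExpr f)‖ := norm_nonneg _
  have ht : t ^ 2 ≤ ‖testToL2 f‖ * (‖testToL2 (freeExpr f)‖ + ‖testToL2 f‖ + t) := by
    nlinarith [sq_nonneg ‖testToL2 (mulWeight (-(1 / 4)) (Dy f))‖]
  by_contra! hlt
  nlinarith

/-- If `Q = O(⟨x⟩^{-1/2})` and `Q = O(⟨y⟩⁻¹)` then `Q D_x` is bounded relative to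
`(D_x + y)² + D_y² + x`. -/
theorem norm_mulBdd_Dx_le {Q : (ℝ × ℝ) →ᵇ ℝ} {C : ℝ}
    (hQx : ∀ p, |Q p| ≤ C * weight (-(1 / 4)) p) (hQy : ∀ p, |Q p| * |p.2| ≤ C) (f : TestFun) :
    ‖mulBdd Q (testToL2 (Dx f))‖ ≤ 3 * C * (‖testToL2 f‖ + ‖testToL2 (freeExpr f)‖) := by
  have hC : 0 ≤ C := (mul_nonneg (abs_nonneg _) (abs_nonneg _)).trans (hQy 0)
  have h1 : ‖mulBdd Q (testToL2 ((Dx + coordY) f))‖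
      ≤ C * ‖testToL2 (mulWeight (-(1 / 4)) ((Dx + coordY) f))‖ := by
    refine norm_mulBdd_testToL2_le fun p => ?_
    rw [mulWeight_apply, norm_mul, Complex.norm_real, Real.norm_of_nonneg (weight_nonneg _ p),
      ← mul_assoc]
    exact mul_le_mul_of_nonneg_right (hQx p) (norm_nonneg _)
  have h2 : ‖mulBdd Q (testToL2 (coordY f))‖ ≤ C * ‖testToL2 f‖ := by
    refine norm_mulBdd_testToL2_le fun p => ?_
    rw [coordY, mulTest_apply, norm_mul, Complex.norm_real, ← mul_assoc]
    exact mul_le_mul_of_nonneg_right (hQy p) (norm_nonneg _)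
  have h3 : mulBdd Q (testToL2 (Dx f))
      = mulBdd Q (testToL2 ((Dx + coordY) f)) - mulBdd Q (testToL2 (coordY f)) := by
    simp
  rw [h3]
  have h4 := mul_le_mul_of_nonneg_left (norm_weighted_kinetic_le f) hC
  have h5 := norm_sub_le (mulBdd Q (testToL2 ((Dx + coordY) f))) (mulBdd Q (testToL2 (coordY f)))
  have h6 := mul_nonneg hC (norm_nonneg (testToL2 (freeExpr f)))
  linarith

/-! ### Translation differences multiplied by `Q` -/

theorem hasDerivAt_translate (f : TestFun) (p : ℝ × ℝ) (t : ℝ) :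
    HasDerivAt (fun s : ℝ => f.1 (p + (s, 0))) (Complex.I * (Dx f).1 (p + (t, 0))) t := by
  have h1 : HasFDerivAt f.1 (fderiv ℝ f.1 (p + (t, 0))) (p + (t, 0)) :=
    (f.2.1.differentiable (by simp) _).hasFDerivAt
  have h2 : HasDerivAt (fun s : ℝ => p + (s, (0 : ℝ))) ((1, 0) : ℝ × ℝ) t :=
    ((hasDerivAt_id t).prodMk (hasDerivAt_const t (0 : ℝ))).const_add p
  have h3 := h1.comp_hasDerivAt t h2
  have h4 : Complex.I * (Dx f).1 (p + (t, 0)) = fderiv ℝ f.1 (p + (t, 0)) (1, 0) := by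
    rw [Dx, momentum_apply, ← mul_assoc]
    simp
  rw [h4]
  exact h3

theorem inner_trans_testToL2_sub (φ : L2) (f : TestFun) (b : ℝ) :
    ⟪φ, trans b (testToL2 f) - testToL2 f⟫_ℂ
      = ∫ s in (0 : ℝ)..b, ⟪φ, trans s (testToL2 (Complex.I • Dx f))⟫_ℂ :=
  inner_trans_sub_eq_integral φ (memLp_test f) (memLp_test (Complex.I • Dx f))
    (Complex.I • Dx f).2.1.continuous (hasDerivAt_translate f) b

/-- Integrate the relative bound along `s ↦ T_s f`, whose derivative is `i D_x T_s f`. For `|s| ≤ 1`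
the commutator at most doubles the graph norm, which turns `3 C` into `6 C`. -/
theorem norm_mulBdd_trans_sub_testToL2_le {Q : (ℝ × ℝ) →ᵇ ℝ} {C : ℝ}
    (hQx : ∀ p, |Q p| ≤ C * weight (-(1 / 4)) p) (hQy : ∀ p, |Q p| * |p.2| ≤ C) (f : TestFun)
    {b : ℝ} (hb : |b| ≤ 1) :
    ‖mulBdd Q (trans b (testToL2 f) - testToL2 f)‖
      ≤ 6 * C * |b| * (‖testToL2 f‖ + ‖testToL2 (freeExpr f)‖) := by
  have hC : 0 ≤ C := (mul_nonneg (abs_nonneg _) (abs_nonneg _)).trans (hQy 0)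
  set g : L2 := mulBdd Q (trans b (testToL2 f) - testToL2 f) with hg
  set S : ℝ := ‖testToL2 f‖ + ‖testToL2 (freeExpr f)‖ with hS
  have hderiv : ∀ s : ℝ, |s| ≤ 1 →
      ‖mulBdd Q (trans s (testToL2 (Complex.I • Dx f)))‖ ≤ 6 * C * S := by
    intro s hs
    have h1 : trans s (testToL2 (Complex.I • Dx f))
        = Complex.I • testToL2 (Dx (transTest s f)) := by
      rw [map_smul, map_smul, trans_testToL2, Dx, momentum_transTest]
    rw [h1, map_smul, norm_smul, Complex.norm_I, one_mul]
    refine (norm_mulBdd_Dx_le hQx hQy (transTest s f)).trans ?_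
    have h2 : ‖testToL2 (transTest s f)‖ = ‖testToL2 f‖ := by rw [← trans_testToL2, norm_trans]
    have h3 : ‖testToL2 (freeExpr (transTest s f))‖ ≤ ‖testToL2 (freeExpr f)‖ + ‖testToL2 f‖ := by
      rw [freeExpr_transTest, map_sub, map_smul, ← trans_testToL2, ← trans_testToL2]
      refine (norm_sub_le _ _).trans ?_
      rw [norm_smul, norm_trans, norm_trans, Complex.norm_real]
      have := mul_le_mul_of_nonneg_right hs (norm_nonneg (testToL2 f))
      rw [Real.norm_eq_abs]
      linarith
    have h4 : ‖testToL2 (transTest s f)‖ + ‖testToL2 (freeExpr (transTest s f))‖ ≤ 2 * S := by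
      have := norm_nonneg (testToL2 (freeExpr f))
      rw [h2, hS]
      linarith
    calc 3 * C * (‖testToL2 (transTest s f)‖ + ‖testToL2 (freeExpr (transTest s f))‖)
        ≤ 3 * C * (2 * S) := mul_le_mul_of_nonneg_left h4 (by positivity)
      _ = 6 * C * S := by ring
  -- Testing `g` against itself replaces an `L²`-valued integral by a scalar one; `Q` is moved to
  -- the other slot for the integration and back under the integral.
  have hself : ‖g‖ * ‖g‖ ≤ (6 * C * |b| * S) * ‖g‖ := by
    have h1 : ‖⟪g, g⟫_ℂ‖ = ‖g‖ * ‖g‖ := by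
      rw [inner_self_eq_norm_sq_to_K, norm_pow, RCLike.norm_ofReal, abs_norm, sq]
    rw [← h1]
    nth_rewrite 2 [hg]
    rw [← inner_mulBdd_left, inner_trans_testToL2_sub]
    refine (intervalIntegral.norm_integral_le_of_norm_le_const (C := ‖g‖ * (6 * C * S))
      fun s hs => ?_).trans (le_of_eq ?_)
    · have hs1 : |s| ≤ 1 := by
        rcases Set.mem_uIoc.1 hs with h | h
        · rw [abs_of_pos h.1]
          exact h.2.trans ((le_abs_self b).trans hb)
        · rw [abs_of_nonpos h.2]
          linarith [neg_le_abs b]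
      rw [inner_mulBdd_left]
      exact (norm_inner_le_norm _ _).trans
        (mul_le_mul_of_nonneg_left (hderiv s hs1) (norm_nonneg _))
    · rw [sub_zero]
      ring
  rcases (norm_nonneg g).eq_or_lt with h0 | h0
  · rw [← h0]
    positivity
  · exact le_of_mul_le_mul_right hself h0

/-! ### The graph of the free Hamiltonian -/

/-- A closed property of pairs `(f, H₀ f)`, `f ∈ C₀^∞`, holds on the graph of `H₀`. -/
theorem H0_graph_induction {P : L2 × L2 → Prop} (hP : IsClosed {x | P x})
    (h : ∀ f : TestFun, P (testToL2 f, testToL2 (freeExpr f))) {x : L2 × L2}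
    (hx : x ∈ H0.graph) : P x := by
  rw [H0, ← H0min_isClosable.graph_closure_eq_closure_graph] at hx
  refine closure_minimal ?_ hP hx
  intro y hy
  obtain ⟨⟨u, hu⟩, h1, h2⟩ := (LinearPMap.mem_graph_iff _).1 hy
  obtain ⟨f, rfl⟩ : ∃ f, testToL2 f = u := hu
  have h3 : y = (testToL2 f, testToL2 (freeExpr f)) :=
    Prod.ext h1.symm (h2.symm.trans (H0min_testToL2 f ⟨f, rfl⟩))
  rw [h3]
  exact h f

theorem testToL2_mem_H0_graph (f : TestFun) : (testToL2 f, testToL2 (freeExpr f)) ∈ H0.graph := by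
  have h1 : (testToL2 f, testToL2 (freeExpr f)) ∈ H0min.graph :=
    (LinearPMap.mem_graph_iff _).2 ⟨⟨testToL2 f, f, rfl⟩, rfl, H0min_testToL2 f ⟨f, rfl⟩⟩
  exact LinearPMap.le_graph_of_le (LinearPMap.le_closure H0min) h1

theorem isClosed_H0_graph : IsClosed (H0.graph : Set (L2 × L2)) :=
  H0min_isClosable.closure_isClosed

theorem inner_H0_graph {x y : L2 × L2} (hx : x ∈ H0.graph) (hy : y ∈ H0.graph) :
    ⟪x.2, y.1⟫_ℂ = ⟪x.1, y.2⟫_ℂ := by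
  refine H0_graph_induction (P := fun x => ⟪x.2, y.1⟫_ℂ = ⟪x.1, y.2⟫_ℂ)
    (isClosed_eq (by fun_prop) (by fun_prop)) (fun f => ?_) hx
  refine H0_graph_induction
    (P := fun y => ⟪testToL2 (freeExpr f), y.1⟫_ℂ = ⟪testToL2 f, y.2⟫_ℂ)
    (isClosed_eq (by fun_prop) (by fun_prop)) (fun g => ?_) hy
  exact isSymmTest_freeExpr f g

theorem trans_mem_H0_graph (h : ℝ) {x : L2 × L2} (hx : x ∈ H0.graph) :
    (trans h x.1, trans h x.2 - (h : ℂ) • trans h x.1) ∈ H0.graph := by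
  refine H0_graph_induction
    (P := fun x => (trans h x.1, trans h x.2 - (h : ℂ) • trans h x.1) ∈ H0.graph)
    ?_ (fun f => ?_) hx
  · refine isClosed_H0_graph.preimage ?_
    have := (trans h).continuous
    fun_prop
  · rw [trans_testToL2, trans_testToL2, ← map_smul, ← map_sub, ← freeExpr_transTest]
    exact testToL2_mem_H0_graph _

theorem norm_mulBdd_trans_sub_le {Q : (ℝ × ℝ) →ᵇ ℝ} {C : ℝ}
    (hQx : ∀ p, |Q p| ≤ C * weight (-(1 / 4)) p) (hQy : ∀ p, |Q p| * |p.2| ≤ C)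
    {x : L2 × L2} (hx : x ∈ H0.graph) {b : ℝ} (hb : |b| ≤ 1) :
    ‖mulBdd Q (trans b x.1 - x.1)‖ ≤ 6 * C * |b| * (‖x.1‖ + ‖x.2‖) := by
  refine H0_graph_induction
    (P := fun x => ‖mulBdd Q (trans b x.1 - x.1)‖ ≤ 6 * C * |b| * (‖x.1‖ + ‖x.2‖))
    (isClosed_le ?_ (by fun_prop))
    (fun f => norm_mulBdd_trans_sub_testToL2_le hQx hQy f hb) hx
  have := (trans b).continuous
  fun_prop

/-! ### The virial identity -/

/-- The derivative of `W` in `x` is `Q`. -/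
def HasXDeriv (W Q : (ℝ × ℝ) →ᵇ ℝ) : Prop :=
  ∀ (p : ℝ × ℝ) (t : ℝ), HasDerivAt (fun s : ℝ => W (p + (s, 0))) (Q (p + (t, 0))) t

theorem inner_mulBdd_eq_integral (Z : (ℝ × ℝ) →ᵇ ℝ) (φ u : L2) :
    ⟪φ, mulBdd Z u⟫_ℂ = ∫ p : ℝ × ℝ, ⟪φ p, u p⟫_ℂ * (Z p : ℂ) := by
  rw [L2.inner_def]
  refine integral_congr_ae ?_
  filter_upwards [coeFn_mulBdd Z u] with p hp
  rw [hp, RCLike.inner_apply, RCLike.inner_apply]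
  ring

/-- The fundamental theorem of calculus for `W` at each point, followed by Fubini; `conj φ · u` is
integrable and `Q` is bounded. -/
theorem inner_mulBdd_transBdd_sub {W Q : (ℝ × ℝ) →ᵇ ℝ} (hWQ : HasXDeriv W Q) (φ u : L2) (h : ℝ) :
    ⟪φ, mulBdd (transBdd h W - W) u⟫_ℂ
      = ∫ s in (0 : ℝ)..h, ⟪φ, mulBdd (transBdd s Q) u⟫_ℂ := by
  simp_rw [inner_mulBdd_eq_integral]
  have hinner : Integrable (fun p : ℝ × ℝ => ⟪φ p, u p⟫_ℂ) := L2.integrable_inner φ u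
  rw [intervalIntegral_integral_swap]
  · congr 1
    ext p
    have hFTC := intervalIntegral.integral_eq_sub_of_hasDerivAt (a := 0) (b := h)
      (fun t _ => hWQ p t)
      ((Q.continuous.comp (by fun_prop : Continuous fun s : ℝ =>
        p + (s, (0 : ℝ)))).intervalIntegrable 0 h)
    simp only [transBdd_apply, BoundedContinuousFunction.sub_apply]
    rw [intervalIntegral.integral_const_mul, intervalIntegral.integral_ofReal, hFTC,
      Prod.mk_zero_zero, add_zero]
  · have : IsFiniteMeasure (volume.restrict (Set.uIoc 0 h)) :=
      inferInstanceAs (IsFiniteMeasure (volume.restrict (Set.Ioc (min 0 h) (max 0 h))))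
    refine (hinner.comp_snd _).mul_bdd (c := ‖Q‖) ?_ (ae_of_all _ fun q => ?_)
    · exact (Complex.continuous_ofReal.comp (Q.continuous.comp (by fun_prop :
        Continuous fun q : ℝ × (ℝ × ℝ) => q.2 + (q.1, (0 : ℝ))))).aestronglyMeasurable
    · rw [Complex.norm_real]
      exact Q.norm_coe_le_norm _

/-- Symmetry of `H₀` between `ψ` and `T_h ψ`: the terms in the real `μ` cancel, leaving the
commutator `h T_h` against the difference of `W` and its translate. Splitting the shift between the
two slots leaves `Q` itself untranslated. -/
theorem virial {W Q : (ℝ × ℝ) →ᵇ ℝ} (hWQ : HasXDeriv W Q) {μ : ℝ} {ψ : L2}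
    (hψ : (ψ, (μ : ℂ) • ψ - mulBdd W ψ) ∈ H0.graph) (h : ℝ) :
    (h : ℂ) * ⟪ψ, trans h ψ⟫_ℂ
      = -∫ s in (0 : ℝ)..h, ⟪trans (-s) ψ, mulBdd Q (trans (h - s) ψ)⟫_ℂ := by
  have h1 := inner_H0_graph hψ (trans_mem_H0_graph h hψ)
  have h2 : ∀ s : ℝ, ⟪trans (-s) ψ, mulBdd Q (trans (h - s) ψ)⟫_ℂ
      = ⟪ψ, mulBdd (transBdd s Q) (trans h ψ)⟫_ℂ := by
    intro s
    rw [inner_trans_left, neg_neg, trans_mulBdd, trans_trans]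
    congr 4
    ring
  simp_rw [h2]
  rw [← inner_mulBdd_transBdd_sub hWQ, mulBdd_sub, ← trans_mulBdd, inner_sub_right]
  simp only [inner_sub_left, inner_sub_right, map_sub, map_smul, inner_smul_left,
    inner_smul_right, Complex.conj_ofReal, inner_mulBdd_left] at h1
  linear_combination h1

/-- The virial identity, with the integral rescaled to the unit interval. -/
theorem inner_trans_self_eq_integral {W Q : (ℝ × ℝ) →ᵇ ℝ} (hWQ : HasXDeriv W Q) {μ : ℝ} {ψ : L2}
    (hψ : (ψ, (μ : ℂ) • ψ - mulBdd W ψ) ∈ H0.graph) (h : ℝ) :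
    ⟪ψ, trans h ψ⟫_ℂ
      = -∫ τ in (0 : ℝ)..1, ⟪trans (-(h * τ)) ψ, mulBdd Q (trans (h * (1 - τ)) ψ)⟫_ℂ := by
  have hc := continuous_trans ψ
  have hL : Continuous fun h : ℝ => ⟪ψ, trans h ψ⟫_ℂ := continuous_const.inner hc
  have hR : Continuous fun h : ℝ =>
      -∫ τ in (0 : ℝ)..1, ⟪trans (-(h * τ)) ψ, mulBdd Q (trans (h * (1 - τ)) ψ)⟫_ℂ := by
    refine (intervalIntegral.continuous_parametric_intervalIntegral_of_continuous' ?_ 0 1).neg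
    refine Continuous.inner (hc.comp (by fun_prop)) ((mulBdd Q).continuous.comp
      (hc.comp (by fun_prop)))
  -- Dividing by `h` requires `h ≠ 0`; continuity recovers `h = 0`, which is the usual virial
  -- theorem.
  refine congrFun (Continuous.ext_on (dense_compl_singleton (0 : ℝ)) hL hR fun k hk => ?_) h
  have hk : k ≠ 0 := hk
  have h1 := virial hWQ hψ k
  have h2 := intervalIntegral.smul_integral_comp_mul_left (a := 0) (b := 1)
    (fun s : ℝ => ⟪trans (-s) ψ, mulBdd Q (trans (k - s) ψ)⟫_ℂ) k
  rw [mul_zero, mul_one] at h2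
  rw [← h2, Complex.real_smul, ← mul_neg] at h1
  have h3 := mul_left_cancel₀ (Complex.ofReal_ne_zero.2 hk) h1
  simp only [h3, mul_sub, mul_one]

/-! ### Difference quotients of eigenfunctions -/

theorem norm_trans_sub_sq (h : ℝ) (ψ : L2) :
    ‖trans h ψ - ψ‖ ^ 2 = 2 * (‖ψ‖ ^ 2 - (⟪ψ, trans h ψ⟫_ℂ).re) := by
  have h1 := norm_sub_sq (𝕜 := ℂ) (trans h ψ) ψ
  rw [norm_trans, inner_re_symm] at h1
  rw [h1]
  simp only [RCLike.re_eq_complex_re]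
  ring

/-- Symmetrizing under `τ ↦ 1 - τ` makes both signs of each shift occur, so that first-order terms
can pair into second differences. -/
theorem norm_trans_sub_sq_eq_integral {W Q : (ℝ × ℝ) →ᵇ ℝ} (hWQ : HasXDeriv W Q) {μ : ℝ} {ψ : L2}
    (hψ : (ψ, (μ : ℂ) • ψ - mulBdd W ψ) ∈ H0.graph) (h : ℝ) :
    ‖trans h ψ - ψ‖ ^ 2 = ∫ τ in (0 : ℝ)..1,
      ((⟪trans (-(h * τ)) ψ, mulBdd Q (trans (h * (1 - τ)) ψ)⟫_ℂ).re
        + (⟪trans (-(h * (1 - τ))) ψ, mulBdd Q (trans (h * τ) ψ)⟫_ℂ).re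
        - 2 * (⟪ψ, mulBdd Q ψ⟫_ℂ).re) := by
  have hc := continuous_trans ψ
  have hcont : Continuous fun τ : ℝ =>
      ⟪trans (-(h * τ)) ψ, mulBdd Q (trans (h * (1 - τ)) ψ)⟫_ℂ :=
    Continuous.inner (hc.comp (by fun_prop)) ((mulBdd Q).continuous.comp
      (hc.comp (by fun_prop)))
  set F : ℝ → ℝ := fun τ => (⟪trans (-(h * τ)) ψ, mulBdd Q (trans (h * (1 - τ)) ψ)⟫_ℂ).re with hF
  have hFc : Continuous F := Complex.continuous_re.comp hcont
  have hFc' : Continuous fun τ : ℝ => F (1 - τ) := hFc.comp (by fun_prop)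
  have hre : (⟪ψ, trans h ψ⟫_ℂ).re = -∫ τ in (0 : ℝ)..1, F τ := by
    rw [inner_trans_self_eq_integral hWQ hψ h, Complex.neg_re]
    congr 1
    exact (Complex.reCLM.intervalIntegral_comp_comm (hcont.intervalIntegrable 0 1)).symm
  have hzero : ‖ψ‖ ^ 2 = -(⟪ψ, mulBdd Q ψ⟫_ℂ).re := by
    have h0 := congrArg Complex.re (inner_trans_self_eq_integral hWQ hψ 0)
    simp only [zero_mul, neg_zero, trans_zero, intervalIntegral.integral_const, sub_zero,
      one_smul, Complex.neg_re] at h0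
    rw [← h0, ← RCLike.re_eq_complex_re, inner_self_eq_norm_sq]
  have hsymm : ∫ τ in (0 : ℝ)..1, F (1 - τ) = ∫ τ in (0 : ℝ)..1, F τ := by
    simp
  have hsum : (fun τ : ℝ => (⟪trans (-(h * τ)) ψ, mulBdd Q (trans (h * (1 - τ)) ψ)⟫_ℂ).re
        + (⟪trans (-(h * (1 - τ))) ψ, mulBdd Q (trans (h * τ) ψ)⟫_ℂ).re
        - 2 * (⟪ψ, mulBdd Q ψ⟫_ℂ).re)
      = fun τ => F τ + F (1 - τ) - 2 * (⟪ψ, mulBdd Q ψ⟫_ℂ).re := by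
    ext τ
    simp only [hF, sub_sub_cancel]
  have hsum_int : IntervalIntegrable (fun τ => F τ + F (1 - τ)) volume 0 1 :=
    (hFc.add hFc').intervalIntegrable 0 1
  rw [hsum, intervalIntegral.integral_sub hsum_int (by simp), intervalIntegral.integral_add (hFc.intervalIntegrable 0 1)
    (hFc'.intervalIntegrable 0 1), hsymm, norm_trans_sub_sq, hre, hzero]
  simp
  ring

theorem abs_sub_transBdd_le {W Q : (ℝ × ℝ) →ᵇ ℝ} (hWQ : HasXDeriv W Q) (h : ℝ) (p : ℝ × ℝ) :
    |(W - transBdd h W) p| ≤ ‖Q‖ * |h| := by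
  have h1 := Convex.norm_image_sub_le_of_norm_hasDerivWithin_le (s := Set.univ) (x := h) (y := 0)
    (C := ‖Q‖) (fun t _ => (hWQ p t).hasDerivWithinAt) (fun t _ => Q.norm_coe_le_norm _)
    convex_univ (Set.mem_univ _) (Set.mem_univ _)
  simpa [Prod.mk_zero_zero] using h1

theorem sub_trans_mem_H0_graph {x : L2 × L2} (hx : x ∈ H0.graph) (a : ℝ) :
    (x.1 - trans (-a) x.1, x.2 - trans (-a) x.2 - (a : ℂ) • trans (-a) x.1) ∈ H0.graph := by
  have h1 := H0.graph.sub_mem hx (trans_mem_H0_graph (-a) hx)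
  convert h1 using 1
  refine Prod.ext rfl ?_
  simp only [Prod.snd_sub]
  push_cast
  module

/-- The left side is the norm of `H₀ (ψ - T_{-a} ψ)` for an eigenfunction. The eigenvalue equation
trades it for `ψ - T_{-a} ψ` itself, plus terms of size `a` from the shift of `W` and from the
commutator. -/
theorem norm_commutator_le {W Q : (ℝ × ℝ) →ᵇ ℝ} (hWQ : HasXDeriv W Q) (μ : ℝ) (ψ : L2) {a : ℝ}
    (ha : 0 ≤ a) :
    ‖((μ : ℂ) • ψ - mulBdd W ψ) - trans (-a) ((μ : ℂ) • ψ - mulBdd W ψ) - (a : ℂ) • trans (-a) ψ‖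
      ≤ (|μ| + ‖W‖) * ‖trans a ψ - ψ‖ + (‖Q‖ + 1) * a * ‖ψ‖ := by
  have h1 : ((μ : ℂ) • ψ - mulBdd W ψ) - trans (-a) ((μ : ℂ) • ψ - mulBdd W ψ)
        - (a : ℂ) • trans (-a) ψ
      = (μ : ℂ) • (ψ - trans (-a) ψ) - mulBdd W (ψ - trans (-a) ψ)
        - mulBdd (W - transBdd (-a) W) (trans (-a) ψ) - (a : ℂ) • trans (-a) ψ := by
    rw [mulBdd_sub, map_sub, map_sub, map_smul, trans_mulBdd]
    module
  have hD : ‖ψ - trans (-a) ψ‖ = ‖trans a ψ - ψ‖ := by rw [norm_sub_rev, norm_trans_neg_sub]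
  have h2 : ‖(μ : ℂ) • (ψ - trans (-a) ψ)‖ = |μ| * ‖trans a ψ - ψ‖ := by
    rw [norm_smul, Complex.norm_real, hD, Real.norm_eq_abs]
  have h3 : ‖mulBdd W (ψ - trans (-a) ψ)‖ ≤ ‖W‖ * ‖trans a ψ - ψ‖ := by
    rw [← hD]
    exact norm_mulBdd_le_of_forall W.norm_coe_le_norm _
  have h4 : ‖mulBdd (W - transBdd (-a) W) (trans (-a) ψ)‖ ≤ ‖Q‖ * a * ‖ψ‖ := by
    have := norm_mulBdd_le_of_forall (abs_sub_transBdd_le hWQ (-a)) (trans (-a) ψ)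
    rwa [norm_trans, abs_neg, abs_of_nonneg ha] at this
  have h5 : ‖(a : ℂ) • trans (-a) ψ‖ = a * ‖ψ‖ := by
    rw [norm_smul, norm_trans, Complex.norm_real, Real.norm_of_nonneg ha]
  rw [h1]
  refine (norm_sub_le _ _).trans ?_
  refine (add_le_add_left ((norm_sub_le _ _).trans
    (add_le_add_left (norm_sub_le _ _) _)) _).trans ?_
  rw [h2, h5]
  linarith

section Growth

variable {W Q : (ℝ × ℝ) →ᵇ ℝ} {C : ℝ} {μ : ℝ} {ψ : L2}

/-- The second difference is `(T_a - 1)(1 - T_{-a}) ψ`: the outer factor gives `a` through the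
relative bound, the inner one has small graph norm. -/
theorem norm_mulBdd_second_difference_le (hWQ : HasXDeriv W Q)
    (hQx : ∀ p, |Q p| ≤ C * weight (-(1 / 4)) p) (hQy : ∀ p, |Q p| * |p.2| ≤ C)
    (hψ : (ψ, (μ : ℂ) • ψ - mulBdd W ψ) ∈ H0.graph) {a : ℝ} (ha : 0 ≤ a) (ha1 : a ≤ 1) :
    ‖mulBdd Q ((trans a ψ - ψ) + (trans (-a) ψ - ψ))‖
      ≤ 6 * C * a * ((1 + |μ| + ‖W‖) * ‖trans a ψ - ψ‖ + (‖Q‖ + 1) * a * ‖ψ‖) := by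
  have hC : 0 ≤ C := (mul_nonneg (abs_nonneg _) (abs_nonneg _)).trans (hQy 0)
  have h1 := norm_mulBdd_trans_sub_le hQx hQy (sub_trans_mem_H0_graph hψ a)
    (b := a) (by rwa [abs_of_nonneg ha])
  have h2 : trans a (ψ - trans (-a) ψ) - (ψ - trans (-a) ψ)
      = (trans a ψ - ψ) + (trans (-a) ψ - ψ) := by
    rw [map_sub, trans_trans, add_neg_cancel, trans_zero]
    abel
  simp only [h2, abs_of_nonneg ha] at h1
  refine h1.trans (mul_le_mul_of_nonneg_left ?_ (by positivity))
  have h3 := norm_commutator_le hWQ μ ψ ha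
  have hD : ‖ψ - trans (-a) ψ‖ = ‖trans a ψ - ψ‖ := by rw [norm_sub_rev, norm_trans_neg_sub]
  rw [hD]
  linarith

/-- Intended for `φ, u = T_{±a} ψ` and `v, w = T_{±b} ψ`. Expand around `ψ`; since `Q` is symmetric,
the real parts of the linear terms combine into the two second differences. -/
theorem re_inner_mulBdd_trans_sub_le (φ u v w : L2) (Q : (ℝ × ℝ) →ᵇ ℝ) :
    (⟪u, mulBdd Q v⟫_ℂ).re + (⟪w, mulBdd Q φ⟫_ℂ).re - 2 * (⟪ψ, mulBdd Q ψ⟫_ℂ).re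
      ≤ ‖ψ‖ * ‖mulBdd Q ((φ - ψ) + (u - ψ))‖ + ‖ψ‖ * ‖mulBdd Q ((v - ψ) + (w - ψ))‖
        + ‖u - ψ‖ * ‖mulBdd Q (v - ψ)‖ + ‖w - ψ‖ * ‖mulBdd Q (φ - ψ)‖ := by
  have hsymm : ∀ x y : L2, (⟪x, mulBdd Q y⟫_ℂ).re = (⟪y, mulBdd Q x⟫_ℂ).re := by
    intro x y
    rw [← inner_mulBdd_left]
    exact inner_re_symm (𝕜 := ℂ) _ _
  have hle : ∀ x y : L2, (⟪x, mulBdd Q y⟫_ℂ).re ≤ ‖x‖ * ‖mulBdd Q y‖ := fun x y =>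
    re_inner_le_norm (𝕜 := ℂ) x (mulBdd Q y)
  have h1 := hle ψ ((φ - ψ) + (u - ψ))
  have h2 := hle ψ ((v - ψ) + (w - ψ))
  have h3 := hle (u - ψ) (v - ψ)
  have h4 := hle (w - ψ) (φ - ψ)
  refine le_trans (le_of_eq ?_) (add_le_add (add_le_add (add_le_add h1 h2) h3) h4)
  simp only [map_add, map_sub, inner_add_right, inner_sub_right, inner_sub_left, Complex.add_re,
    Complex.sub_re]
  rw [hsymm ψ u, hsymm ψ w]
  ring

/-- The growth of `‖T_h ψ - ψ‖²` is controlled by the smaller translates of `ψ`. -/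
theorem exists_norm_trans_sub_sq_le (hWQ : HasXDeriv W Q)
    (hQx : ∀ p, |Q p| ≤ C * weight (-(1 / 4)) p) (hQy : ∀ p, |Q p| * |p.2| ≤ C)
    (hψ : (ψ, (μ : ℂ) • ψ - mulBdd W ψ) ∈ H0.graph) :
    ∃ L : ℝ, 0 ≤ L ∧ ∀ h m : ℝ, 0 ≤ h → h ≤ 1 →
      (∀ a : ℝ, 0 ≤ a → a ≤ h → ‖trans a ψ - ψ‖ ≤ m) →
      ‖trans h ψ - ψ‖ ^ 2 ≤ L * h * (h + m) := by
  have hC : 0 ≤ C := (mul_nonneg (abs_nonneg _) (abs_nonneg _)).trans (hQy 0)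
  set N : ℝ := ‖ψ‖ + ‖(μ : ℂ) • ψ - mulBdd W ψ‖ with hN
  set A : ℝ := 6 * C * (1 + |μ| + ‖W‖ + (‖Q‖ + 1) * ‖ψ‖) with hA
  have hA0 : 0 ≤ A := by positivity
  have hN0 : 0 ≤ N := by positivity
  -- Two second differences contribute `‖ψ‖ A` each, two products of first differences `6 C N` each.
  refine ⟨2 * (‖ψ‖ * A) + 2 * (6 * C * N), by positivity, fun h m hh hh1 hm => ?_⟩
  have hm0 : 0 ≤ m := (norm_nonneg _).trans (hm 0 le_rfl hh)
  have hsecond : ∀ a : ℝ, 0 ≤ a → a ≤ h →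
      ‖mulBdd Q ((trans a ψ - ψ) + (trans (-a) ψ - ψ))‖ ≤ A * h * (h + m) := by
    intro a ha hah
    refine (norm_mulBdd_second_difference_le hWQ hQx hQy hψ ha (hah.trans hh1)).trans ?_
    calc 6 * C * a * ((1 + |μ| + ‖W‖) * ‖trans a ψ - ψ‖ + (‖Q‖ + 1) * a * ‖ψ‖)
        ≤ 6 * C * h * ((1 + |μ| + ‖W‖) * (h + m) + (‖Q‖ + 1) * (h + m) * ‖ψ‖) := by
          have := hm a ha hah
          gcongr <;> linarith
      _ = A * h * (h + m) := by
          rw [hA]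
          ring
  have hfirst : ∀ a : ℝ, 0 ≤ a → a ≤ h → ‖mulBdd Q (trans a ψ - ψ)‖ ≤ 6 * C * N * h := by
    intro a ha hah
    refine (norm_mulBdd_trans_sub_le hQx hQy hψ
      (by rw [abs_of_nonneg ha]; exact hah.trans hh1)).trans ?_
    rw [abs_of_nonneg ha]
    calc 6 * C * a * (‖ψ‖ + ‖(μ : ℂ) • ψ - mulBdd W ψ‖)
        ≤ 6 * C * h * N := by gcongr
      _ = 6 * C * N * h := by ring
  have hneg : ∀ a : ℝ, 0 ≤ a → a ≤ h → ‖trans (-a) ψ - ψ‖ ≤ h + m := by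
    intro a ha hah
    rw [norm_trans_neg_sub]
    linarith [hm a ha hah]
  have hcross : ∀ a b : ℝ, 0 ≤ a → a ≤ h → 0 ≤ b → b ≤ h →
      ‖trans (-a) ψ - ψ‖ * ‖mulBdd Q (trans b ψ - ψ)‖ ≤ 6 * C * N * h * (h + m) := by
    intro a b ha hah hb hbh
    rw [mul_comm (6 * C * N * h)]
    exact mul_le_mul (hneg a ha hah) (hfirst b hb hbh) (norm_nonneg _) (by linarith)
  have hbound : ∀ τ ∈ Set.Icc (0 : ℝ) 1,
      (⟪trans (-(h * τ)) ψ, mulBdd Q (trans (h * (1 - τ)) ψ)⟫_ℂ).re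
        + (⟪trans (-(h * (1 - τ))) ψ, mulBdd Q (trans (h * τ) ψ)⟫_ℂ).re
        - 2 * (⟪ψ, mulBdd Q ψ⟫_ℂ).re
      ≤ (2 * (‖ψ‖ * A) + 2 * (6 * C * N)) * h * (h + m) := by
    intro τ hτ
    have ha : 0 ≤ h * τ := mul_nonneg hh hτ.1
    have hah : h * τ ≤ h := mul_le_of_le_one_right hh hτ.2
    have hb : 0 ≤ h * (1 - τ) := mul_nonneg hh (by linarith [hτ.2])
    have hbh : h * (1 - τ) ≤ h := mul_le_of_le_one_right hh (by linarith [hτ.1])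
    refine (re_inner_mulBdd_trans_sub_le _ _ _ _ Q).trans ?_
    have h1 := mul_le_mul_of_nonneg_left (hsecond _ ha hah) (norm_nonneg ψ)
    have h2 := mul_le_mul_of_nonneg_left (hsecond _ hb hbh) (norm_nonneg ψ)
    have h3 := hcross _ _ ha hah hb hbh
    have h4 := hcross _ _ hb hbh ha hah
    linarith
  rw [norm_trans_sub_sq_eq_integral hWQ hψ h]
  have hc := continuous_trans ψ
  have hcont : Continuous fun τ : ℝ =>
      (⟪trans (-(h * τ)) ψ, mulBdd Q (trans (h * (1 - τ)) ψ)⟫_ℂ).re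
        + (⟪trans (-(h * (1 - τ))) ψ, mulBdd Q (trans (h * τ) ψ)⟫_ℂ).re
        - 2 * (⟪ψ, mulBdd Q ψ⟫_ℂ).re := by
    refine Continuous.sub (Continuous.add ?_ ?_) continuous_const <;>
    exact Complex.continuous_re.comp (Continuous.inner (hc.comp (by fun_prop))
      ((mulBdd Q).continuous.comp (hc.comp (by fun_prop))))
  have hmono := intervalIntegral.integral_mono_on zero_le_one (hcont.intervalIntegrable 0 1)
    (intervalIntegrable_const (μ := volume) (c := (2 * (‖ψ‖ * A) + 2 * (6 * C * N)) * h * (h + m))) hbound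
  simpa using hmono

/-- The difference quotients of an eigenfunction are bounded. -/
theorem exists_norm_trans_sub_le (hWQ : HasXDeriv W Q)
    (hQx : ∀ p, |Q p| ≤ C * weight (-(1 / 4)) p) (hQy : ∀ p, |Q p| * |p.2| ≤ C)
    (hψ : (ψ, (μ : ℂ) • ψ - mulBdd W ψ) ∈ H0.graph) :
    ∃ K : ℝ, ∀ h : ℝ, 0 ≤ h → h ≤ 1 → ‖trans h ψ - ψ‖ ≤ K * h := by
  obtain ⟨L, hL, hmain⟩ := exists_norm_trans_sub_sq_le hWQ hQx hQy hψ
  refine ⟨L + 1, fun h hh hh1 => ?_⟩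
  -- At a maximum point `t` over `[0, h]` the bound closes on itself: `D(t)² ≤ L t (t + D(t))`,
  -- which forces `D(t) ≤ (L + 1) t`.
  obtain ⟨t, ht, hmax⟩ := isCompact_Icc.exists_isMaxOn (Set.nonempty_Icc.2 hh)
    ((continuous_trans ψ).sub continuous_const |>.norm.continuousOn (s := Set.Icc 0 h))
  have hmax' : ∀ a : ℝ, 0 ≤ a → a ≤ h → ‖trans a ψ - ψ‖ ≤ ‖trans t ψ - ψ‖ :=
    fun a h0 h1 => hmax (Set.mem_Icc.2 ⟨h0, h1⟩)
  have h1 := hmain t _ ht.1 (ht.2.trans hh1) fun a h0 h1 => hmax' a h0 (h1.trans ht.2)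
  have h2 : ‖trans t ψ - ψ‖ ≤ (L + 1) * t := by
    set D := ‖trans t ψ - ψ‖
    by_contra! hlt
    have h3 : 0 ≤ t := ht.1
    have h4 : 0 < D := lt_of_le_of_lt (by positivity) hlt
    nlinarith [mul_nonneg hL h3, mul_pos h4 (sub_pos.2 hlt)]
  exact (hmax' h hh le_rfl).trans (h2.trans (mul_le_mul_of_nonneg_left ht.2 (by linarith)))

end Growth

/-! ### Bounded difference quotients and the distributional derivative -/

/-- The distributional pairing is bilinear while the inner product is conjugate-linear in its first
slot, hence the `star`. -/
theorem toTemperedDistribution_eq_inner (u : L2) (φ : 𝓢(ℝ × ℝ, ℂ)) :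
    Lp.toTemperedDistribution u φ = ⟪star u, φ.toLp 2⟫_ℂ := by
  rw [Lp.toTemperedDistribution_apply, L2.inner_def]
  refine integral_congr_ae ?_
  filter_upwards [φ.coeFn_toLp 2 volume, Lp.coeFn_star u] with p h1 h2
  rw [h1, h2, RCLike.inner_apply, Pi.star_apply, smul_eq_mul]
  simp

theorem trans_star (h : ℝ) (u : L2) : trans h (star u) = star (trans h u) := by
  refine Lp.ext ?_
  filter_upwards [coeFn_trans h (star u), Lp.coeFn_star (trans h u), coeFn_trans h u,
    ae_comp_add (Lp.coeFn_star u) (h, 0)] with p h1 h2 h3 h4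
  rw [h1, h2, h4, Pi.star_apply, Pi.star_apply, h3]

theorem star_sub_L2 (u w : L2) : star (u - w) = star u - star w := by
  refine Lp.ext ?_
  filter_upwards [Lp.coeFn_star (u - w), Lp.coeFn_sub u w, Lp.coeFn_star u, Lp.coeFn_star w,
    Lp.coeFn_sub (star u) (star w)] with p h1 h2 h3 h4 h5
  rw [h1, h5, Pi.star_apply, h2, Pi.sub_apply, Pi.sub_apply, h3, h4, Pi.star_apply,
    Pi.star_apply, star_sub]

theorem norm_star_L2 (u : L2) : ‖star u‖ = ‖u‖ := by
  have h : ∀ᵐ p : ℝ × ℝ, ‖(star u : L2) p‖ = ‖u p‖ := by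
    filter_upwards [Lp.coeFn_star u] with p h1
    rw [h1, Pi.star_apply, norm_star]
  exact le_antisymm (Lp.norm_le_norm_of_ae_le (h.mono fun _ => le_of_eq))
    (Lp.norm_le_norm_of_ae_le (h.mono fun _ => ge_of_eq))

theorem hasDerivAt_inner_trans_schwartz (u : L2) (φ : 𝓢(ℝ × ℝ, ℂ)) :
    HasDerivAt (fun b : ℝ => ⟪u, trans b (φ.toLp 2)⟫_ℂ)
      ⟪u, (∂_{((1 : ℝ), (0 : ℝ))} φ).toLp 2⟫_ℂ 0 := by
  set φ' : 𝓢(ℝ × ℝ, ℂ) := ∂_{((1 : ℝ), (0 : ℝ))} φ with hφ'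
  have hd : ∀ (p : ℝ × ℝ) (t : ℝ),
      HasDerivAt (fun s : ℝ => φ (p + (s, 0))) (φ' (p + (t, 0))) t := by
    intro p t
    have h2 : HasDerivAt (fun s : ℝ => p + (s, (0 : ℝ))) ((1, 0) : ℝ × ℝ) t :=
      ((hasDerivAt_id t).prodMk (hasDerivAt_const t (0 : ℝ))).const_add p
    exact (φ.differentiableAt (x := p + (t, 0))).hasFDerivAt.comp_hasDerivAt t h2
  have hftc := inner_trans_sub_eq_integral u (φ.memLp 2 volume) (φ'.memLp 2 volume)
    φ'.continuous hd
  have hcont : Continuous fun s : ℝ => ⟪u, trans s (φ'.toLp 2)⟫_ℂ :=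
    continuous_const.inner (continuous_trans _)
  have h1 := intervalIntegral.integral_hasDerivAt_right (hcont.intervalIntegrable 0 0)
    (hcont.stronglyMeasurableAtFilter _ _) hcont.continuousAt
  rw [trans_zero] at h1
  refine (h1.add_const ⟪u, φ.toLp 2⟫_ℂ).congr_of_eventuallyEq (Eventually.of_forall fun b => ?_)
  change ⟪u, trans b (φ.toLp 2)⟫_ℂ = (∫ s in (0 : ℝ)..b, ⟪u, trans s (φ'.toLp 2)⟫_ℂ) + _
  have h2 : ⟪u, trans b (φ.toLp 2) - φ.toLp 2 volume⟫_ℂ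
      = ∫ s in (0 : ℝ)..b, ⟪u, trans s (φ'.toLp 2)⟫_ℂ := hftc b
  rw [← h2, inner_sub_right, sub_add_cancel]

/-- The pairing is a derivative at `0` of translates of `φ`; moving the translation onto `ψ` bounds
every difference quotient by `K ‖φ‖`. -/
theorem norm_inner_star_lineDeriv_le {ψ : L2} {K : ℝ}
    (hK : ∀ h : ℝ, 0 ≤ h → h ≤ 1 → ‖trans h ψ - ψ‖ ≤ K * h) (φ : 𝓢(ℝ × ℝ, ℂ)) :
    ‖⟪star ψ, (∂_{((1 : ℝ), (0 : ℝ))} φ).toLp 2⟫_ℂ‖ ≤ K * ‖φ.toLp 2 (volume : Measure (ℝ × ℝ))‖ := by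
  have hK0 : 0 ≤ K := by simpa using (norm_nonneg _).trans (hK 1 zero_le_one le_rfl)
  refine (hasDerivAt_inner_trans_schwartz (star ψ) φ).le_of_lip' (by positivity) ?_
  filter_upwards [Metric.ball_mem_nhds (0 : ℝ) one_pos] with b hb
  have hb1 : |b| ≤ 1 := by
    rw [Metric.mem_ball, Real.dist_eq, sub_zero] at hb
    exact hb.le
  have h1 : ‖trans b ψ - ψ‖ ≤ K * |b| := by
    rcases abs_cases b with ⟨h, h'⟩ | ⟨h, h'⟩
    · have := hK |b| (abs_nonneg b) hb1
      rwa [h] at this ⊢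
    · have := hK |b| (abs_nonneg b) hb1
      rw [h] at this ⊢
      rwa [norm_trans_neg_sub] at this
  have h2 : ⟪star ψ, trans b (φ.toLp 2)⟫_ℂ - ⟪star ψ, trans 0 (φ.toLp 2)⟫_ℂ
      = ⟪star (trans (-b) ψ - ψ), φ.toLp 2⟫_ℂ := by
    rw [trans_zero, inner_trans_right, trans_star, star_sub_L2, inner_sub_left]
  rw [h2, sub_zero, Real.norm_eq_abs]
  refine (norm_inner_le_norm _ _).trans ?_
  rw [norm_star_L2, norm_trans_neg_sub]
  have := mul_le_mul_of_nonneg_right h1 (norm_nonneg (φ.toLp 2 (volume : Measure (ℝ × ℝ))))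
  linarith

/-- If the difference quotients of `ψ` in `x` are bounded in `L²`, then `D_x ψ ∈ L²`. -/
theorem dxMemL2_of_norm_trans_sub_le {ψ : L2} {K : ℝ}
    (hK : ∀ h : ℝ, 0 ≤ h → h ≤ 1 → ‖trans h ψ - ψ‖ ≤ K * h) : DxMemL2 ψ := by
  obtain ⟨e, he⟩ : ∃ e : 𝓢(ℝ × ℝ, ℂ) →ₗ[ℂ] L2, ∀ φ, e φ = φ.toLp 2 volume :=
    ⟨(SchwartzMap.toLpCLM ℂ ℂ 2 (volume : Measure (ℝ × ℝ))).toLinearMap, fun _ => rfl⟩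
  obtain ⟨ℓ, hℓ⟩ : ∃ ℓ : 𝓢(ℝ × ℝ, ℂ) →ₗ[ℂ] ℂ,
      ∀ φ, ℓ φ = Complex.I * ⟪star ψ, (∂_{((1 : ℝ), (0 : ℝ))} φ).toLp 2 volume⟫_ℂ :=
    ⟨Complex.I • ((innerₛₗ ℂ (star ψ)) ∘ₗ e ∘ₗ
      (LineDeriv.lineDerivOpCLM ℂ 𝓢(ℝ × ℝ, ℂ) ((1 : ℝ), (0 : ℝ))).toLinearMap), fun φ => by
      simp [he]⟩
  have hdense : DenseRange e := by
    have h : (e : 𝓢(ℝ × ℝ, ℂ) → L2)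
        = SchwartzMap.toLpCLM ℝ ℂ 2 (volume : Measure (ℝ × ℝ)) := funext he
    rw [h]
    exact SchwartzMap.denseRange_toLpCLM (by simp)
  have hbound : ∃ C, ∀ φ, ‖ℓ φ‖ ≤ C * ‖e φ‖ := by
    refine ⟨K, fun φ => ?_⟩
    rw [hℓ, he, norm_mul, Complex.norm_I, one_mul]
    exact norm_inner_star_lineDeriv_le hK φ
  -- The functional `φ ↦ (D_x ψ)(φ)` is bounded in `L²` norm on the dense Schwartz space, so it
  -- extends and has a Riesz representative.
  set w : L2 := (InnerProductSpace.toDual ℂ L2).symm (ℓ.extendOfNorm e) with hw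
  have hwφ : ∀ φ : 𝓢(ℝ × ℝ, ℂ), ⟪w, φ.toLp 2⟫_ℂ
      = Complex.I * ⟪star ψ, (∂_{((1 : ℝ), (0 : ℝ))} φ).toLp 2⟫_ℂ := by
    intro φ
    rw [hw, InnerProductSpace.toDual_symm_apply, ← he, LinearMap.extendOfNorm_eq hdense hbound,
      hℓ]
  refine ⟨star w, ?_⟩
  ext φ
  rw [toTemperedDistribution_eq_inner, star_star, hwφ, ← toTemperedDistribution_eq_inner]
  change -Complex.I • Lp.toTemperedDistribution ψ (-(∂_{((1 : ℝ), (0 : ℝ))} φ)) = _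
  rw [map_neg, smul_eq_mul]
  ring

/-! ### Eigenfunctions -/

theorem mem_H0_graph_of_isEigenfunction (W : (ℝ × ℝ) →ᵇ ℝ) {μ : ℂ} {ψ : L2}
    (hψ : IsEigenfunction (H W) μ ψ) : (ψ, μ • ψ - mulBdd W ψ) ∈ H0.graph := by
  obtain ⟨-, h, heq⟩ := hψ
  have h1 : H0 ⟨ψ, h.1⟩ + mulBdd W ψ = μ • ψ := heq
  exact (LinearPMap.mem_graph_iff _).2 ⟨⟨ψ, h.1⟩, rfl, eq_sub_of_add_eq h1⟩

/-- Symmetry of `H₀` and of multiplication by the real `W`; the virial identity needs a real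
eigenvalue. -/
theorem ofReal_re_eigenvalue (W : (ℝ × ℝ) →ᵇ ℝ) {μ : ℂ} {ψ : L2} (hne : ψ ≠ 0)
    (hψ : (ψ, μ • ψ - mulBdd W ψ) ∈ H0.graph) : (μ.re : ℂ) = μ := by
  have h := inner_H0_graph hψ hψ
  simp only [inner_sub_left, inner_sub_right, inner_smul_left, inner_smul_right,
    inner_mulBdd_left, sub_left_inj] at h
  exact Complex.conj_eq_iff_re.1 (mul_right_cancel₀ (inner_self_ne_zero.2 hne) h)

theorem exists_abs_le_of_tendsto_cocompact {f : ℝ × ℝ → ℝ} (hf : Continuous f)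
    (h0 : Tendsto f (cocompact (ℝ × ℝ)) (𝓝 0)) : ∃ C, ∀ p, |f p| ≤ C := by
  set F : ZeroAtInftyContinuousMap (ℝ × ℝ) ℝ := ⟨⟨f, hf⟩, h0⟩
  exact ⟨‖F.toBCF‖, fun p => F.toBCF.norm_coe_le_norm p⟩

theorem one_le_bracket (t : ℝ) : 1 ≤ bracket t :=
  Real.one_le_sqrt.2 (by nlinarith [sq_nonneg t])

theorem abs_le_bracket (t : ℝ) : |t| ≤ bracket t := by
  rw [← Real.sqrt_sq_eq_abs]
  exact Real.sqrt_le_sqrt (by linarith)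

theorem continuous_bracket : Continuous bracket := by
  unfold bracket
  fun_prop

theorem weight_mul_bracket_rpow (p : ℝ × ℝ) :
    bracket p.1 ^ (1 / 2 : ℝ) * weight (-(1 / 4)) p = 1 := by
  have hpos : (0 : ℝ) < 1 + p.1 ^ 2 := by positivity
  rw [bracket, weight, Real.sqrt_eq_rpow, ← Real.rpow_mul hpos.le, ← Real.rpow_add hpos]
  norm_num

end MagneticStark

end

/-! ### The main theorem -/

open MagneticStark in
theorem proposition4p1
    (V Vx : ℝ × ℝ → ℝ)
    (hV : Continuous V)
    (hVx : ∀ x y : ℝ, HasDerivAt (fun t : ℝ => V (t, y)) (Vx (x, y)) x)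
    (hVx_cont : Continuous Vx)
    (A₂ : ℝ)
    (hV_bound : ∀ x y : ℝ, MagneticStark.bracket x ^ (1 / 2 : ℝ) * MagneticStark.bracket y * |V (x, y)| ≤ A₂)
    (hV_lim : Tendsto (fun p : ℝ × ℝ => MagneticStark.bracket p.1 ^ (1 / 2 : ℝ) * V p)
      (cocompact (ℝ × ℝ)) (𝓝 0))
    (hVx_lim : Tendsto (fun p : ℝ × ℝ => MagneticStark.bracket p.1 ^ (1 / 2 : ℝ) * Vx p)
      (cocompact (ℝ × ℝ)) (𝓝 0))
    (hVx_lim' : Tendsto (fun p : ℝ × ℝ => MagneticStark.bracket p.2 * Vx p)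
      (cocompact (ℝ × ℝ)) (𝓝 0))
    (μ : ℂ) (ψ : MagneticStark.L2) (hψ : MagneticStark.IsEigenfunction (MagneticStark.H V) μ ψ) :
    MagneticStark.DxMemL2 ψ := by
  have hrpow : ∀ t, 1 ≤ bracket t ^ (1 / 2 : ℝ) := fun t =>
    Real.one_le_rpow (one_le_bracket t) (by norm_num)
  have hcont : Continuous fun p : ℝ × ℝ => bracket p.1 ^ (1 / 2 : ℝ) :=
    (continuous_bracket.comp continuous_fst).rpow_const fun _ => Or.inr (by norm_num)
  -- Of the decay of `Vx` only boundedness of `⟨x⟩^{1/2} Vx` and `⟨y⟩ Vx` is needed: these are the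
  -- two hypotheses of the relative bound for `Q D_x`.
  obtain ⟨C₁, hC₁⟩ := exists_abs_le_of_tendsto_cocompact (f := fun p => _ * Vx p)
    (hcont.mul hVx_cont) hVx_lim
  obtain ⟨C₂, hC₂⟩ := exists_abs_le_of_tendsto_cocompact (f := fun p => _ * Vx p)
    ((continuous_bracket.comp continuous_snd).mul hVx_cont) hVx_lim'
  have hV_le : ∀ p, ‖V p‖ ≤ A₂ := fun p => by
    refine le_trans ?_ (hV_bound p.1 p.2)
    exact le_mul_of_one_le_left (abs_nonneg _)
      (one_le_mul_of_one_le_of_one_le (hrpow _) (one_le_bracket _))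
  have hVx_weight : ∀ p, |Vx p| ≤ C₁ * weight (-(1 / 4)) p := fun p => by
    have h1 := mul_le_mul_of_nonneg_right (hC₁ p) (weight_nonneg (-(1 / 4)) p)
    rwa [abs_mul, abs_of_nonneg (zero_le_one.trans (hrpow _)), mul_right_comm,
      weight_mul_bracket_rpow, one_mul] at h1
  have hC₁_nonneg : 0 ≤ C₁ := (abs_nonneg _).trans (hC₁ 0)
  have hVx_y : ∀ p : ℝ × ℝ, |Vx p| * |p.2| ≤ C₂ := fun p => by
    refine le_trans ?_ (hC₂ p)
    change _ ≤ |bracket p.2 * Vx p|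
    rw [abs_mul, abs_of_nonneg (zero_le_one.trans (one_le_bracket _)), mul_comm]
    exact mul_le_mul_of_nonneg_right (abs_le_bracket _) (abs_nonneg _)
  set W := BoundedContinuousFunction.ofNormedAddCommGroup V hV A₂ hV_le
  set Q := BoundedContinuousFunction.ofNormedAddCommGroup Vx hVx_cont C₁ fun p =>
    (hVx_weight p).trans (mul_le_of_le_one_right hC₁_nonneg (weight_le_one (by norm_num) p))
  have hWQ : HasXDeriv W Q := fun p t => by
    change HasDerivAt (fun s : ℝ => V (p.1 + s, p.2 + 0)) (Vx (p.1 + t, p.2 + 0)) t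
    exact (hVx (p.1 + t) (p.2 + 0)).comp_const_add p.1 t
  have hgraph := mem_H0_graph_of_isEigenfunction W hψ
  rw [← ofReal_re_eigenvalue W hψ.1 hgraph] at hgraph
  obtain ⟨K, hK⟩ := exists_norm_trans_sub_le (C := max C₁ C₂) hWQ
    (fun p => (hVx_weight p).trans
      (mul_le_mul_of_nonneg_right (le_max_left _ _) (weight_nonneg _ p)))
    (fun p => (hVx_y p).trans (le_max_right _ _)) hgraph
  exact dxMemL2_of_norm_trans_sub_le hK
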